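/- **Setting.** Let $(\mathcal S,\mathcal A,P,r,\gamma,\beta)$ be an action-triggered sporadically traceable MDP: $\mathcal S$ is a measurable state space, $\mathcal A$ a finite action set with $A=|\mathcal A|$, $P(\cdot\mid s,a)$ a transition probability kernel, $r:\mathcal S\times\mathcal A\to[0,1]$ the reward, $\gamma\in(0,1)$ the discount factor, and $\beta:\mathcal A\to[0,1]$, where $\beta_a=\beta(a)$ is the probability that executing $a$ triggers a data-burst. Assume it is linear of dimension $d$: there are a (measurable) feature map $\phi:\mathcal S\times\mathcal A\to\mathbb R^d$, a vector $\mu=(\mu_1,\dots,\mu_d)$ of finite signed measures on $\mathcal S$ and $\theta\in\mathbb R^d$ with $P(\cdot\mid s,a)=\langle\phi(s,a),\mu(\cdot)\rangle$, $r(s,a)=\langle\phi(s,a),\theta\rangle$, $\|\phi(s,a)\|_2\le1$ for all $(s,a)$, $\|\theta\|_2\le\sqrt d$ and $\|(|\mu_1|(\mathcal S),\dots,|\mu_d|(\mathcal S))\|_2\le\sqrt d$. The map $\phi$ is known. **Feature map.** The action-matrices are $M_a=\int_{\mathcal S}\mu(ds)\,\phi(s,a)^\top\in\mathbb R^{d\times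 d}$. For $\mathbf a=(a_1,a_2,\dots)\in\mathcal A^{\mathbb N}$ put $$M_1(\mathbf a)=I+\sum_{k\ge1}\gamma^k\Big(\prod_{i=1}^{k-1}(1-\beta_{a_i})\Big)M_{a_1}\cdots M_{a_k},\qquad M_2(\mathbf a)=\sum_{k\ge1}\gamma^k\Big(\prod_{i=1}^{k-1}(1-\beta_{a_i})\Big)\beta_{a_k}M_{a_1}\cdots M_{a_k}.$$ The action-sequence feature map $\psi:\mathcal S\times\mathcal A^{\mathbb N}\to\mathbb R^{2d}$ is given, for an action $a$ followed by a sequence $\mathbf a$, by $$\psi(s,a\oplus\mathbf a)^\top=\tfrac12\,\phi(s,a)^\top\Big(\beta_a\big[(1-\gamma)I\;\;\gamma I\big]+(1-\beta_a)\big[(1-\gamma)M_1(\mathbf a)\;\;\gamma M_2(\mathbf a)\big]\Big).$$ A map $\widehat\psi:\mathcal S\times\mathcal A^{\mathbb N}\to\mathbb R^{2d}$ is an $\varepsilon$-admissible estimation of $\psi$ if $\sup_{s,\mathbf a}\|\widehat\psi(s,\mathbf a)-\psi(s,\mathbf a)\|_2\le\varepsilon$, $\sup_{s,\mathbf a}\|\widehat\psi(s,\mathbf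 a)\|_2\le1$, and $\widehat\psi(s,\cdot)$ is continuous for the product topology on $\mathcal A^{\mathbb N}$ (with $\mathcal A$ discrete) for every $s\in\mathcal S$. **Data.** Let $\mathcal D$ be a probability distribution on $\mathcal S\times\mathcal A$ whose second moment matrix $\Sigma=\mathbb E_{(s,a)\sim\mathcal D}[\phi(s,a)\phi(s,a)^\top]$ is positive definite, with smallest eigenvalue $\lambda_{\min}(\Sigma)$, and let $p_{\min}=\min_{a\in\mathcal A}\mathcal D(\mathcal S\times\{a\})$. The data are $N$ i.i.d. tuples $(s_n,a_n,s_n',b_n)$ with $(s_n,a_n)\sim\mathcal D$ and, given $(s_n,a_n)$, independently $s_n'\sim P(\cdot\mid s_n,a_n)$ and $b_n\sim\mathrm{Ber}(\beta_{a_n})$. **Estimators.** $\widehat M_a=(X^\top X+I)^{-1}X^\top Y_a$, where $X,Y_a\in\mathbb R^{N\times d}$ have rows $\phi(s_n,a_n)$ and $\phi(s_n',a)$ respectively (ridge regression with parameter $1$), and $\widehat\beta_a=\sum_n b_n\mathbf 1(a_n=a)\big/\sum_n\mathbf 1(a_n=a)$ (with $0/0=0$). Given tolerances $\varepsilon_M,\varepsilon_\beta\ge0$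 and estimates of the action-matrices and burst probabilities, the normalized estimated feature map is $$\widetilde\psi=\frac{\widehat\psi}{1+16d(\varepsilon_M+\varepsilon_\beta/\sqrt d)/(1-\gamma)},$$ where $\widehat\psi$ is obtained from the formula for $\psi$ by replacing all $M_a$ and $\beta_a$ by their estimates. For a target accuracy $\varepsilon$ the tolerances are taken such that $32d(\varepsilon_M+\varepsilon_\beta/\sqrt d)/(1-\gamma)=\varepsilon$, so that $\widetilde\psi=\widehat\psi/(1+\varepsilon/2)$. Let $\widetilde\psi^{M,\beta}$ be the map $\widetilde\psi$ computed from $\widehat M_a$ and $\widehat\beta_a$, and let $\widetilde\psi^{M}$ be the map $\widetilde\psi$ computed from $\widehat M_a$ and the true $\beta_a$, with $\varepsilon_\beta=0$. **Statement.** There is an absolute constant $c>0$ such that, in every such setting and for all $p,\varepsilon\in(0,1)$: 1. if $p_{\min}>0$ and $\displaystyle N\ge c\cdot\frac{d^3\log(2Ad/p)}{\varepsilon^2(1-\gamma)^2\min\{\lambda_{\min}(\Sigma)^2,\;d^2p_{\min}\}}$, then with probability at least $1-p$ the map $\widetilde\psi^{M,\beta}$ is an $\varepsilon$-admissible estimation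 of $\psi$; 2. if $\displaystyle N\ge c\cdot\frac{d^3\log(2Ad/p)}{\varepsilon^2(1-\gamma)^2\lambda_{\min}(\Sigma)^2}$, then with probability at least $1-p$ the map $\widetilde\psi^{M}$ is an $\varepsilon$-admissible estimation of $\psi$. -/

import Mathlib

open MeasureTheory ProbabilityTheory
open scoped Matrix

namespace ATST

/-- An action-triggered sporadically traceable Markov decision process
`(S, A, P, r, γ, β)`: a discounted MDP together with, for every action `a`, the probability
`β a` that executing `a` triggers a data-burst. -/
structure MDP (S A : Type*) [MeasurableSpace S] [MeasurableSpace A] where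
  /-- transition probabilities `P(· | s, a)` -/
  P : Kernel (S × A) S
  isMarkov : IsMarkovKernel P
  /-- reward function -/
  r : S → A → ℝ
  r_mem : ∀ s a, r s a ∈ Set.Icc (0 : ℝ) 1
  /-- discount factor -/
  γ : ℝ
  γ_mem : γ ∈ Set.Ioo (0 : ℝ) 1
  /-- data-burst probabilities -/
  β : A → unitInterval

attribute [instance] MDP.isMarkov

/-- The linear MDP structure in dimension `d`: a feature map `φ`, a vector `μ` of `d` finite signed
measures and a vector `θ` that represent transitions and rewards linearly, with the usual
normalization. -/
structure LinearModel {S A : Type*} [MeasurableSpace S] [MeasurableSpace A]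
    (𝓜 : MDP S A) (d : ℕ) where
  φ : S × A → EuclideanSpace ℝ (Fin d)
  φ_measurable : Measurable φ
  μ : Fin d → SignedMeasure S
  θ : EuclideanSpace ℝ (Fin d)
  transition : ∀ s a (B : Set S), MeasurableSet B →
    (𝓜.P (s, a)).real B = ∑ i, φ (s, a) i * μ i B
  reward : ∀ s a, 𝓜.r s a = inner ℝ (φ (s, a)) θ
  norm_φ_le : ∀ s a, ‖φ (s, a)‖ ≤ 1
  norm_θ_le : ‖θ‖ ≤ √d
  norm_μ_le : ‖WithLp.toLp 2 (fun i => ((μ i).totalVariation Set.univ).toReal)‖ ≤ √d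

section FeatureMap

variable {S A : Type*} {d : ℕ}

/-- The action-matrix `M(a) = ∫ μ(ds) φ(s, a)ᵀ`. -/
noncomputable def LinearModel.actionMatrix [MeasurableSpace S] [MeasurableSpace A]
    {𝓜 : MDP S A} (L : LinearModel 𝓜 d) (a : A) : Matrix (Fin d) (Fin d) ℝ :=
  Matrix.of fun i j =>
    (L.μ i).integral (fun s => L.φ (s, a) j) (ContinuousLinearMap.lsmul ℝ ℝ).flip

/-- The ordered product `M(a₁) M(a₂) ⋯ M(aₖ)`; the sequence `a₁, a₂, …` is indexed from `0`. -/
noncomputable def matProd (M : A → Matrix (Fin d) (Fin d) ℝ) (a : ℕ → A) :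
    ℕ → Matrix (Fin d) (Fin d) ℝ
  | 0 => 1
  | k + 1 => matProd M a k * M (a k)

/-- The type 1 action-sequence matrix
`M₁(a) = I + ∑_{k ≥ 1} γᵏ (∏_{i < k} (1 - β(aᵢ))) M(a₁) ⋯ M(aₖ)` (summation index `k + 1`). -/
noncomputable def seqMatrix₁ (γ : ℝ) (β : A → ℝ) (M : A → Matrix (Fin d) (Fin d) ℝ)
    (a : ℕ → A) : Matrix (Fin d) (Fin d) ℝ :=
  1 + ∑' k : ℕ, (γ ^ (k + 1) * ∏ i ∈ Finset.range k, (1 - β (a i))) • matProd M a (k + 1)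

/-- The type 2 action-sequence matrix
`M₂(a) = ∑_{k ≥ 1} γᵏ (∏_{i < k} (1 - β(aᵢ))) β(aₖ) M(a₁) ⋯ M(aₖ)` (summation index `k + 1`). -/
noncomputable def seqMatrix₂ (γ : ℝ) (β : A → ℝ) (M : A → Matrix (Fin d) (Fin d) ℝ)
    (a : ℕ → A) : Matrix (Fin d) (Fin d) ℝ :=
  ∑' k : ℕ, (γ ^ (k + 1) * (∏ i ∈ Finset.range k, (1 - β (a i))) * β (a k)) •
    matProd M a (k + 1)

/-- The action-sequence feature map built from features `φ`, burst probabilities `β` and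
action-matrices `M`: for a state `s` and the action sequence `a ⊕ 𝐚`, it is the row vector
`½ φ(s, a)ᵀ (β(a) [(1-γ)I  γI] + (1 - β(a)) [(1-γ)M₁(𝐚)  γM₂(𝐚)])` in `ℝ^{2d}`, whose coordinates
are indexed by `Fin d ⊕ Fin d`. -/
noncomputable def featureMap (φ : S × A → EuclideanSpace ℝ (Fin d)) (γ : ℝ) (β : A → ℝ)
    (M : A → Matrix (Fin d) (Fin d) ℝ) (s : S) (a : ℕ → A) :
    EuclideanSpace ℝ (Fin d ⊕ Fin d) :=
  let tail : ℕ → A := fun n => a (n + 1)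
  WithLp.toLp 2 ((1 / 2 : ℝ) • ((φ (s, a 0)).ofLp ᵥ*
    (β (a 0) • Matrix.fromCols ((1 - γ) • (1 : Matrix (Fin d) (Fin d) ℝ))
        (γ • (1 : Matrix (Fin d) (Fin d) ℝ)) +
      (1 - β (a 0)) • Matrix.fromCols ((1 - γ) • seqMatrix₁ γ β M tail)
        (γ • seqMatrix₂ γ β M tail))))

/-- The true action-sequence feature map `ψ`. -/
noncomputable def LinearModel.ψ [MeasurableSpace S] [MeasurableSpace A]
    {𝓜 : MDP S A} (L : LinearModel 𝓜 d) :
    S → (ℕ → A) → EuclideanSpace ℝ (Fin d ⊕ Fin d) :=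
  featureMap L.φ 𝓜.γ (fun a => (𝓜.β a : ℝ)) L.actionMatrix

/-- The normalized feature map `ψ̃ = ψ̂ / (1 + 16 d (εM + εβ / √d) / (1 - γ))`, where `ψ̂` is
computed from the estimates `β`, `M`, and `εM`, `εβ` are the error tolerances for the
action-matrices and for the burst probabilities. -/
noncomputable def normalizedFeatureMap (φ : S × A → EuclideanSpace ℝ (Fin d)) (γ : ℝ)
    (β : A → ℝ) (M : A → Matrix (Fin d) (Fin d) ℝ) (εM εβ : ℝ) (s : S) (a : ℕ → A) :
    EuclideanSpace ℝ (Fin d ⊕ Fin d) :=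
  (1 + 16 * d * (εM + εβ / √d) / (1 - γ))⁻¹ • featureMap φ γ β M s a

/-- `ψhat` is an `ε`-admissible estimation of `ψ`. -/
def IsAdmissible [TopologicalSpace A] (ε : ℝ)
    (ψ ψhat : S → (ℕ → A) → EuclideanSpace ℝ (Fin d ⊕ Fin d)) : Prop :=
  (∀ s a, ‖ψhat s a - ψ s a‖ ≤ ε) ∧ (∀ s a, ‖ψhat s a‖ ≤ 1) ∧ ∀ s, Continuous (ψhat s)

end FeatureMap

section OffPolicy

variable {S A : Type*} {d N : ℕ}

/-- A data point `((s, a), (s', b))`: state, action, next state, burst indicator. -/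
abbrev Sample (S A : Type*) : Type _ := (S × A) × (S × Bool)

variable [MeasurableSpace S] [MeasurableSpace A]

/-- The kernel `a ↦ Ber(β(a))`. -/
noncomputable def MDP.burstKernel [Countable A] [MeasurableSingletonClass A] (𝓜 : MDP S A) :
    Kernel A Bool :=
  Kernel.ofFunOfCountable fun a => bernoulliMeasure true false (𝓜.β a)

instance [Countable A] [MeasurableSingletonClass A] (𝓜 : MDP S A) :
    IsMarkovKernel 𝓜.burstKernel where
  isProbabilityMeasure a := by
    change IsProbabilityMeasure (bernoulliMeasure true false (𝓜.β a))
    infer_instance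

/-- The law of one data point: `(s, a) ∼ D` and, given `(s, a)`, independently `s' ∼ P(· | s, a)`
and `b ∼ Ber(β(a))`. -/
noncomputable def MDP.sampleLaw [Countable A] [MeasurableSingletonClass A] (𝓜 : MDP S A)
    (D : Measure (S × A)) : Measure (Sample S A) :=
  D ⊗ₘ (𝓜.P ×ₖ Kernel.prodMkLeft S 𝓜.burstKernel)

/-- The second moment matrix `Σ = 𝔼[φ(s₁, a₁) φ(s₁, a₁)ᵀ]`. -/
noncomputable def secondMoment (φ : S × A → EuclideanSpace ℝ (Fin d)) (D : Measure (S × A)) :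
    Matrix (Fin d) (Fin d) ℝ :=
  Matrix.of fun i j => ∫ z, φ z i * φ z j ∂D

/-- The smallest (real) eigenvalue of a matrix. -/
noncomputable def lambdaMin (B : Matrix (Fin d) (Fin d) ℝ) : ℝ := sInf (spectrum ℝ B)

/-- `p_min = inf_a Pr(a₁ = a)`. -/
noncomputable def pMin (D : Measure (S × A)) : ℝ := ⨅ a : A, D.real {z | z.2 = a}

/-- The ridge estimator `(XᵀX + lam I)⁻¹ Xᵀ Yₐ` of the action-matrix of `a`, where `X` and `Yₐ`
have the rows `φ(sₙ, aₙ)` and `φ(s'ₙ, a)`. -/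
noncomputable def ridge (φ : S × A → EuclideanSpace ℝ (Fin d)) (lam : ℝ)
    (z : Fin N → Sample S A) (a : A) : Matrix (Fin d) (Fin d) ℝ :=
  let X : Matrix (Fin N) (Fin d) ℝ := Matrix.of fun n j => φ (z n).1 j
  let Y : Matrix (Fin N) (Fin d) ℝ := Matrix.of fun n j => φ ((z n).2.1, a) j
  (Xᵀ * X + lam • (1 : Matrix (Fin d) (Fin d) ℝ))⁻¹ * Xᵀ * Y

open Classical in
/-- The empirical burst frequency of `a` (equal to `0` if `a` does not occur in the data). -/
noncomputable def empiricalBurst (z : Fin N → Sample S A) (a : A) : ℝ :=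
  (∑ n, if (z n).1.2 = a ∧ (z n).2.2 = true then (1 : ℝ) else 0) /
    ∑ n, if (z n).1.2 = a then (1 : ℝ) else 0

/-- The property `good` holds with `Pr`-probability at least `q`; since the set of good outcomes
need not be measurable, this asks for a measurable event of probability at least `q` inside it. -/
def HoldsWithProb {Ω : Type*} [MeasurableSpace Ω] (Pr : Measure Ω) (q : ℝ) (good : Ω → Prop) :
    Prop :=
  ∃ E : Set Ω, MeasurableSet E ∧ (∀ ω ∈ E, good ω) ∧ q ≤ Pr.real E

end OffPolicy

end ATST

/-!
The feature `ψ` is built from products `M(a₁) ⋯ M(aₖ)`, and a perturbation of the action-matrices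
could be amplified by such a product, since a single `M(a)` may have operator norm `√d`. The remedy
is the norm `‖u‖ₜ = sup ‖u M(a₁) ⋯ M(aₖ)‖` over all products (`TrajBound`). Every `M(a)` is a
contraction for it; `‖φ(s, a)‖ₜ ≤ 1`, because `φ(s, a) M(a₁) ⋯ M(aₖ)` is an expected feature along a
trajectory (`LinearModel.trajBound_φ`); and `‖u‖ ≤ ‖u‖ₜ ≤ √d ‖u‖` by the normalization of `μ`
(`LinearModel.trajBound_of_l2`). Hence an error `e` in the Euclidean operator norm makes an estimated
action-matrix expand `‖·‖ₜ` by at most `1 + √d e`, which the discount factor absorbs.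

The matrices `β(a) I + (1 - β(a)) Mᵢ(𝐚)` solve a fixed point equation `G(a) = w(a₁) I + (1 - β(a₁)) γ
M(a₂) G(a₂, a₃, …)` (`StepEq`). Comparing the equations for the true and the estimated parameters
bounds the error by the error of one step divided by the contraction gap
(`StepEq.l2_vecMul_sub_le`), so that accuracy `ε (1 - γ) / (64 √d)` for the action-matrices and
`ε (1 - γ) / 64` for the burst probabilities suffices (`isAdmissible_of_close`).

This accuracy holds with high probability. The Gram matrix `XᵀX` and the noise `Xᵀ(Y - X M)` are sums
of i.i.d. bounded vectors in the Frobenius norm, and a dimension-free Hoeffding inequality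
(`measure_norm_sum_ge_le`) controls both; it follows from `𝔼 cosh ‖x + Z‖ ≤ cosh ‖x‖ cosh B` for
centred `Z` with `‖Z‖ ≤ B`, a consequence of the convexity of `cosh ∘ √`. The burst frequencies need
a Bernstein inequality (`measure_sum_ge_le_bernstein`), because the sample size is only of order
`1 / p_min`: both the number of occurrences of an action and the number of its bursts have variance
proportional to its probability. A union bound over the actions concludes.
-/

namespace ATST

/-! ### Euclidean norms of coordinate vectors -/

section L2

variable {ι κ : Type*} [Fintype ι] [Fintype κ]

/-- The Euclidean norm of a coordinate vector (the type `ι → ℝ` itself carries the sup norm). -/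
noncomputable def l2 (u : ι → ℝ) : ℝ := ‖WithLp.toLp 2 u‖

theorem l2_nonneg (u : ι → ℝ) : 0 ≤ l2 u := norm_nonneg _

theorem l2_add_le (u v : ι → ℝ) : l2 (u + v) ≤ l2 u + l2 v := by
  simpa [l2] using norm_add_le (WithLp.toLp 2 u) (WithLp.toLp 2 v)

theorem l2_smul (c : ℝ) (u : ι → ℝ) : l2 (c • u) = |c| * l2 u := by
  simp [l2, norm_smul]

@[simp] theorem l2_zero : l2 (0 : ι → ℝ) = 0 := by simp [l2]

theorem l2_neg (u : ι → ℝ) : l2 (-u) = l2 u := by simp [l2]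

theorem l2_sq (u : ι → ℝ) : l2 u ^ 2 = ∑ i, u i ^ 2 := by
  simp [l2, EuclideanSpace.norm_sq_eq]

theorem dotProduct_self_eq_l2_sq (u : ι → ℝ) : u ⬝ᵥ u = l2 u ^ 2 := by
  rw [l2_sq]
  simp [dotProduct, sq]

theorem abs_apply_le_l2 (u : ι → ℝ) (i : ι) : |u i| ≤ l2 u := by
  simpa [l2] using PiLp.norm_apply_le (WithLp.toLp 2 u) i

theorem abs_dotProduct_le (u v : ι → ℝ) : |u ⬝ᵥ v| ≤ l2 u * l2 v := by
  have h := abs_real_inner_le_norm (WithLp.toLp 2 u) (WithLp.toLp 2 v)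
  simpa [l2, PiLp.inner_apply, dotProduct, mul_comm] using h

/-- Duality: the Euclidean norm is bounded as soon as all pairings are. -/
theorem l2_le_of_forall_dotProduct_le {u : ι → ℝ} {C : ℝ} (hC : 0 ≤ C)
    (h : ∀ w : ι → ℝ, u ⬝ᵥ w ≤ C * l2 w) : l2 u ≤ C := by
  rcases (l2_nonneg u).eq_or_lt with h0 | h0
  · exact h0 ▸ hC
  · have := h u
    rw [dotProduct_self_eq_l2_sq, sq] at this
    exact le_of_mul_le_mul_right this h0

theorem l2_le_sum_abs (u : ι → ℝ) : l2 u ≤ ∑ i, |u i| := by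
  refine l2_le_of_forall_dotProduct_le (Finset.sum_nonneg fun _ _ => abs_nonneg _) fun w => ?_
  rw [dotProduct, Finset.sum_mul]
  refine Finset.sum_le_sum fun i _ => (le_abs_self _).trans ?_
  rw [abs_mul]
  exact mul_le_mul_of_nonneg_left (abs_apply_le_l2 w i) (abs_nonneg _)

theorem l2_single_one [DecidableEq ι] (i : ι) : l2 (Pi.single i (1 : ℝ)) = 1 := by
  have := l2_sq (Pi.single i (1 : ℝ))
  rw [Finset.sum_eq_single i (by intro j _ hj; simp [hj]) (by simp)] at this
  simp only [Pi.single_eq_same, one_pow] at this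
  exact (pow_eq_one_iff_of_nonneg (l2_nonneg _) two_ne_zero).1 this

/-- The Euclidean operator norm is at most the Frobenius norm. -/
theorem l2_vecMul_le (u : ι → ℝ) (W : Matrix ι κ ℝ) :
    l2 (u ᵥ* W) ≤ l2 u * l2 (fun q : ι × κ => W q.1 q.2) := by
  refine le_of_sq_le_sq ?_ (mul_nonneg (l2_nonneg _) (l2_nonneg _))
  rw [mul_pow, l2_sq, l2_sq, l2_sq, Fintype.sum_prod_type, Finset.sum_comm, Finset.mul_sum]
  exact Finset.sum_le_sum fun j _ => Finset.sum_mul_sq_le_sq_mul_sq _ _ _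

end L2

/-! ### Trajectory bounds -/

section Traj

variable {A : Type*} {d : ℕ}

theorem matProd_succ' (M : A → Matrix (Fin d) (Fin d) ℝ) (a : ℕ → A) (k : ℕ) :
    matProd M a (k + 1) = M (a 0) * matProd M (fun n => a (n + 1)) k := by
  induction k with
  | zero => simp [matProd]
  | succ k ih => rw [matProd, ih, matProd, Matrix.mul_assoc]

/-- `u` stays of norm at most `r` under every product of action-matrices. The least such `r` is a
norm for which all action-matrices are contractions; the predicate spares taking a supremum. -/
def TrajBound (M : A → Matrix (Fin d) (Fin d) ℝ) (u : Fin d → ℝ) (r : ℝ) : Prop :=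
  ∀ (k : ℕ) (a : ℕ → A), l2 (u ᵥ* matProd M a k) ≤ r

variable {M : A → Matrix (Fin d) (Fin d) ℝ} {u v : Fin d → ℝ} {r s : ℝ}

theorem TrajBound.l2_le [Nonempty A] (h : TrajBound M u r) : l2 u ≤ r := by
  simpa [matProd] using h 0 (fun _ => Classical.arbitrary A)

theorem TrajBound.nonneg [Nonempty A] (h : TrajBound M u r) : 0 ≤ r :=
  (l2_nonneg u).trans h.l2_le

theorem TrajBound.mono (h : TrajBound M u r) (hrs : r ≤ s) : TrajBound M u s :=
  fun k a => (h k a).trans hrs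

theorem TrajBound.add (hu : TrajBound M u r) (hv : TrajBound M v s) :
    TrajBound M (u + v) (r + s) := fun k a => by
  rw [Matrix.add_vecMul]
  exact (l2_add_le _ _).trans (add_le_add (hu k a) (hv k a))

theorem TrajBound.vecMul (h : TrajBound M u r) (a : A) : TrajBound M (u ᵥ* M a) r := fun k b => by
  have := h (k + 1) (fun n => Nat.casesOn n a b)
  rw [matProd_succ'] at this
  simpa [Matrix.vecMul_vecMul] using this

/-- `M'` expands the trajectory norm of `M` by a factor of at most `ρ`. -/
def Expands (M M' : A → Matrix (Fin d) (Fin d) ℝ) (ρ : ℝ) : Prop :=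
  ∀ u r a, TrajBound M u r → TrajBound M (u ᵥ* M' a) (ρ * r)

theorem expands_self : Expands M M 1 := fun u r a h => by simpa using h.vecMul a

theorem Expands.matProd {M' : A → Matrix (Fin d) (Fin d) ℝ} {ρ : ℝ} (h : Expands M M' ρ)
    (hu : TrajBound M u r) (a : ℕ → A) (k : ℕ) :
    TrajBound M (u ᵥ* matProd M' a k) (ρ ^ k * r) := by
  induction k with
  | zero => simpa [ATST.matProd] using hu
  | succ k ih =>
    rw [ATST.matProd, ← Matrix.vecMul_vecMul, pow_succ', mul_assoc]
    exact h _ _ _ ih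

/-- If every vector has a trajectory norm controlled by its Euclidean norm, then a perturbation
small in the Euclidean operator norm expands the trajectory norm only slightly. -/
theorem trajBound_vecMul_sub [Nonempty A] {M' : A → Matrix (Fin d) (Fin d) ℝ} {C e : ℝ}
    (hC : 0 ≤ C) (he : 0 ≤ e)
    (hM : ∀ u, TrajBound M u (C * l2 u)) (h : ∀ u a, l2 (u ᵥ* (M' a - M a)) ≤ e * l2 u)
    (hu : TrajBound M u r) (a : A) : TrajBound M (u ᵥ* (M' a - M a)) (C * e * r) := by
  refine (hM _).mono ?_
  rw [mul_assoc]
  exact mul_le_mul_of_nonneg_left ((h u a).trans (mul_le_mul_of_nonneg_left hu.l2_le he)) hC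

theorem expands_of_sub {M' : A → Matrix (Fin d) (Fin d) ℝ} {δ : ℝ}
    (h : ∀ u r a, TrajBound M u r → TrajBound M (u ᵥ* (M' a - M a)) (δ * r)) :
    Expands M M' (1 + δ) := fun u r a hu => by
  have := (hu.vecMul a).add (h u r a hu)
  rw [Matrix.vecMul_sub, add_sub_cancel] at this
  exact this.mono (by linarith)

/-- Each entry of a product of `k` expanding matrices is bounded by a geometric sequence. -/
theorem Expands.abs_matProd_apply_le [Nonempty A] {M' : A → Matrix (Fin d) (Fin d) ℝ} {ρ C : ℝ}
    (h : Expands M M' ρ) (hM : ∀ u, TrajBound M u (C * l2 u)) (a : ℕ → A) (k : ℕ) (i j : Fin d) :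
    |ATST.matProd M' a k i j| ≤ ρ ^ k * C := by
  have h1 := (h.matProd (hM (Pi.single i 1)) a k).l2_le
  have h2 := abs_apply_le_l2 (Pi.single i 1 ᵥ* ATST.matProd M' a k) j
  rw [l2_single_one, mul_one] at h1
  rw [Matrix.single_one_vecMul] at h1 h2
  exact h2.trans h1

/-- Value iteration: if a bound `C + t` always improves to `C + q t` with `q < 1`, then any
a priori bound improves to `C`. -/
theorem bound_of_contraction {e : (Fin d → ℝ) → (ℕ → A) → ℝ} {C K q : ℝ} (hq0 : 0 ≤ q)
    (hq1 : q < 1) (hK : 0 ≤ K)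
    (hapriori : ∀ u r a, TrajBound M u r → e u a ≤ (C + K) * r)
    (hstep : ∀ t, 0 ≤ t → (∀ u r a, TrajBound M u r → e u a ≤ (C + t) * r) →
      ∀ u r a, TrajBound M u r → e u a ≤ (C + q * t) * r)
    (hu : TrajBound M u r) (a : ℕ → A) : e u a ≤ C * r := by
  have key : ∀ n : ℕ, ∀ u r a, TrajBound M u r → e u a ≤ (C + q ^ n * K) * r := by
    intro n
    induction n with
    | zero => simpa using hapriori
    | succ n ih =>
      have := hstep (q ^ n * K) (by positivity) ih
      simpa [pow_succ', mul_assoc] using this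
  have hlim : Filter.Tendsto (fun n : ℕ => (C + q ^ n * K) * r) Filter.atTop
      (nhds ((C + 0 * K) * r)) :=
    ((((tendsto_pow_atTop_nhds_zero_of_lt_one hq0 hq1).mul_const K).const_add C).mul_const r)
  simpa using ge_of_tendsto' hlim fun n => key n u r a hu

end Traj

/-! ### The series defining the action-sequence matrices -/

section Series

variable {A : Type*} {d : ℕ} {M M' : A → Matrix (Fin d) (Fin d) ℝ} {γ ρ C : ℝ}

theorem norm_smul_matProd_apply_le [Nonempty A] (h : Expands M M' ρ) (hM : ∀ u, TrajBound M u (C * l2 u)) (a : ℕ → A) {c : ℝ} {k : ℕ}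
    (hc : |c| ≤ γ ^ (k + 1)) (i j : Fin d) :
    ‖(c • matProd M' a (k + 1)) i j‖ ≤ C * (γ * ρ) ^ (k + 1) := by
  rw [Matrix.smul_apply, norm_smul, Real.norm_eq_abs, Real.norm_eq_abs, mul_pow]
  calc |c| * |matProd M' a (k + 1) i j| ≤ γ ^ (k + 1) * (ρ ^ (k + 1) * C) :=
        mul_le_mul hc (h.abs_matProd_apply_le hM a _ i j) (abs_nonneg _) ((abs_nonneg _).trans hc)
    _ = _ := by ring

theorem summable_geometric_bound (hγ : 0 ≤ γ) (hρ : 0 ≤ ρ) (hq : γ * ρ < 1) :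
    Summable fun k : ℕ => C * (γ * ρ) ^ (k + 1) :=
  ((summable_nat_add_iff 1).2 (summable_geometric_of_lt_one (mul_nonneg hγ hρ) hq)).mul_left C

theorem summable_smul_matProd [Nonempty A] (hγ : 0 ≤ γ) (hρ : 0 ≤ ρ)
    (hq : γ * ρ < 1) (h : Expands M M' ρ) (hM : ∀ u, TrajBound M u (C * l2 u)) (a : ℕ → A)
    {c : ℕ → ℝ} (hc : ∀ k, |c k| ≤ γ ^ (k + 1)) :
    Summable fun k => c k • matProd M' a (k + 1) := by
  refine Pi.summable.2 fun i => Pi.summable.2 fun j => ?_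
  exact Summable.of_norm_bounded (summable_geometric_bound hγ hρ hq)
    fun k => norm_smul_matProd_apply_le h hM a (hc k) i j

theorem tsum_smul_matProd_apply [Nonempty A] (hγ : 0 ≤ γ) (hρ : 0 ≤ ρ)
    (hq : γ * ρ < 1) (h : Expands M M' ρ) (hM : ∀ u, TrajBound M u (C * l2 u)) (a : ℕ → A)
    {c : ℕ → ℝ} (hc : ∀ k, |c k| ≤ γ ^ (k + 1)) (i j : Fin d) :
    (∑' k, c k • matProd M' a (k + 1)) i j = ∑' k, (c k • matProd M' a (k + 1)) i j := by
  have hs := summable_smul_matProd hγ hρ hq h hM a hc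
  exact (congrFun (tsum_apply (x := i) hs) j).trans (tsum_apply (Pi.summable.1 hs i))

theorem abs_tsum_smul_matProd_apply_le [Nonempty A] (hγ : 0 ≤ γ) (hρ : 0 ≤ ρ)
    (hq : γ * ρ < 1) (h : Expands M M' ρ) (hM : ∀ u, TrajBound M u (C * l2 u)) (a : ℕ → A)
    {c : ℕ → ℝ} (hc : ∀ k, |c k| ≤ γ ^ (k + 1)) (i j : Fin d) :
    |(∑' k, c k • matProd M' a (k + 1)) i j| ≤ ∑' k, C * (γ * ρ) ^ (k + 1) := by
  rw [tsum_smul_matProd_apply hγ hρ hq h hM a hc]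
  exact tsum_of_norm_bounded (summable_geometric_bound hγ hρ hq).hasSum
    fun k => norm_smul_matProd_apply_le h hM a (hc k) i j

theorem continuous_matProd [TopologicalSpace A] [DiscreteTopology A]
    (M : A → Matrix (Fin d) (Fin d) ℝ) (k : ℕ) : Continuous fun a : ℕ → A => matProd M a k := by
  induction k with
  | zero => exact continuous_const
  | succ k ih => exact ih.mul ((continuous_of_discreteTopology (f := M)).comp (continuous_apply k))

theorem continuous_tsum_smul_matProd [Nonempty A] [TopologicalSpace A] [DiscreteTopology A]
    (hγ : 0 ≤ γ) (hρ : 0 ≤ ρ)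
    (hq : γ * ρ < 1) (h : Expands M M' ρ) (hM : ∀ u, TrajBound M u (C * l2 u))
    {c : ℕ → (ℕ → A) → ℝ} (hcc : ∀ k, Continuous (c k)) (hc : ∀ k a, |c k a| ≤ γ ^ (k + 1)) :
    Continuous fun a => ∑' k, c k a • matProd M' a (k + 1) := by
  refine continuous_pi fun i => continuous_pi fun j => ?_
  simp only [fun a => tsum_smul_matProd_apply hγ hρ hq h hM a (fun k => hc k a) i j]
  refine continuous_tsum (fun k => ?_) (summable_geometric_bound hγ hρ hq)
    fun k a => norm_smul_matProd_apply_le h hM a (hc k a) i j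
  exact ((hcc k).smul (continuous_matProd M' (k + 1))).matrix_elem i j

variable {β : A → ℝ}

theorem prod_one_sub_mem (hβ : ∀ a, β a ∈ Set.Icc (0 : ℝ) 1) (a : ℕ → A) (k : ℕ) :
    ∏ i ∈ Finset.range k, (1 - β (a i)) ∈ Set.Icc (0 : ℝ) 1 :=
  ⟨Finset.prod_nonneg fun i _ => sub_nonneg.2 (hβ _).2,
    Finset.prod_le_one (fun i _ => sub_nonneg.2 (hβ _).2) fun i _ => by linarith [(hβ (a i)).1]⟩

theorem abs_coeff₁_le (hγ : 0 ≤ γ) (hβ : ∀ a, β a ∈ Set.Icc (0 : ℝ) 1) (a : ℕ → A) (k : ℕ) :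
    |γ ^ (k + 1) * ∏ i ∈ Finset.range k, (1 - β (a i))| ≤ γ ^ (k + 1) := by
  have h := prod_one_sub_mem hβ a k
  rw [abs_of_nonneg (mul_nonneg (by positivity) h.1)]
  exact mul_le_of_le_one_right (by positivity) h.2

theorem abs_coeff₂_le (hγ : 0 ≤ γ) (hβ : ∀ a, β a ∈ Set.Icc (0 : ℝ) 1) (a : ℕ → A) (k : ℕ) :
    |γ ^ (k + 1) * (∏ i ∈ Finset.range k, (1 - β (a i))) * β (a k)| ≤ γ ^ (k + 1) := by
  rw [abs_mul, abs_of_nonneg (hβ (a k)).1]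
  exact (mul_le_of_le_one_right (abs_nonneg _) (hβ _).2).trans (abs_coeff₁_le hγ hβ a k)

theorem continuous_prod_one_sub [TopologicalSpace A] [DiscreteTopology A] (β : A → ℝ) (k : ℕ) :
    Continuous fun a : ℕ → A => ∏ i ∈ Finset.range k, (1 - β (a i)) :=
  continuous_finsetProd _ fun i _ =>
    continuous_const.sub ((continuous_of_discreteTopology (f := β)).comp (continuous_apply i))

/-- The matrix `β(a) I + (1 - β(a)) M₁(𝐚)` occurring in the feature of `a ⊕ 𝐚`. -/
noncomputable def stepMatrix₁ (γ : ℝ) (β : A → ℝ) (M : A → Matrix (Fin d) (Fin d) ℝ)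
    (a : ℕ → A) : Matrix (Fin d) (Fin d) ℝ :=
  β (a 0) • (1 : Matrix (Fin d) (Fin d) ℝ) +
    (1 - β (a 0)) • seqMatrix₁ γ β M fun n => a (n + 1)

/-- The matrix `β(a) I + (1 - β(a)) M₂(𝐚)` occurring in the feature of `a ⊕ 𝐚`. -/
noncomputable def stepMatrix₂ (γ : ℝ) (β : A → ℝ) (M : A → Matrix (Fin d) (Fin d) ℝ)
    (a : ℕ → A) : Matrix (Fin d) (Fin d) ℝ :=
  β (a 0) • (1 : Matrix (Fin d) (Fin d) ℝ) +
    (1 - β (a 0)) • seqMatrix₂ γ β M fun n => a (n + 1)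

theorem featureMap_eq {S : Type*} (φ : S × A → EuclideanSpace ℝ (Fin d)) (s : S) (a : ℕ → A) :
    featureMap φ γ β M s a = WithLp.toLp 2 ((1 / 2 : ℝ) • Sum.elim
      ((1 - γ) • ((φ (s, a 0)).ofLp ᵥ* stepMatrix₁ γ β M a))
      (γ • ((φ (s, a 0)).ofLp ᵥ* stepMatrix₂ γ β M a))) := by
  unfold featureMap stepMatrix₁ stepMatrix₂
  dsimp only
  congr 2
  ext (i | i) <;>
    simp [Matrix.vecMul_add, Matrix.vecMul_smul, Matrix.vecMul_fromCols] <;> ring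

theorem l2_sumElim_le {ι κ : Type*} [Fintype ι] [Fintype κ] (u : ι → ℝ) (v : κ → ℝ) :
    l2 (Sum.elim u v) ≤ l2 u + l2 v := by
  refine le_of_sq_le_sq ?_ (add_nonneg (l2_nonneg _) (l2_nonneg _))
  rw [l2_sq, Fintype.sum_sum_type]
  simp only [Sum.elim_inl, Sum.elim_inr]
  rw [← l2_sq, ← l2_sq]
  nlinarith [l2_nonneg u, l2_nonneg v]

/-- The recursion `M₁(𝐚) = I + γ M(a₁) (β(a₁) I + (1 - β(a₁)) M₁(a₂, a₃, …))`. -/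
theorem seqMatrix₁_eq [Nonempty A] (hγ : 0 ≤ γ) (hρ : 0 ≤ ρ)
    (hq : γ * ρ < 1) (h : Expands M M' ρ) (hM : ∀ u, TrajBound M u (C * l2 u))
    (hβ : ∀ a, β a ∈ Set.Icc (0 : ℝ) 1) (a : ℕ → A) :
    seqMatrix₁ γ β M' a = 1 + γ • (M' (a 0) * stepMatrix₁ γ β M' a) := by
  have hs := summable_smul_matProd hγ hρ hq h hM a (abs_coeff₁_le hγ hβ a)
  have hs' := summable_smul_matProd hγ hρ hq h hM (fun n => a (n + 1))
    (abs_coeff₁_le hγ hβ fun n => a (n + 1))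
  rw [seqMatrix₁, hs.tsum_eq_zero_add]
  have : ∀ k, (γ ^ (k + 1 + 1) * ∏ i ∈ Finset.range (k + 1), (1 - β (a i))) •
      matProd M' a (k + 1 + 1) = (γ * (1 - β (a 0))) • (M' (a 0) *
        ((γ ^ (k + 1) * ∏ i ∈ Finset.range k, (1 - β (a (i + 1)))) •
          matProd M' (fun n => a (n + 1)) (k + 1))) := fun k => by
    rw [matProd_succ', Finset.prod_range_succ', Matrix.mul_smul, smul_smul]
    congr 1
    ring
  simp only [this]
  rw [(hs'.mul_left (M' (a 0))).tsum_const_smul, hs'.tsum_mul_left, stepMatrix₁, seqMatrix₁]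
  simp only [matProd, Finset.range_zero, Finset.prod_empty, mul_one, zero_add, pow_one, one_mul,
    mul_add, Matrix.mul_smul, smul_add, smul_smul]
  congr 1
  rw [← add_assoc, ← add_smul]
  congr 2
  ring

/-- The recursion `M₂(𝐚) = γ M(a₁) (β(a₁) I + (1 - β(a₁)) M₂(a₂, a₃, …))`. -/
theorem seqMatrix₂_eq [Nonempty A] (hγ : 0 ≤ γ) (hρ : 0 ≤ ρ)
    (hq : γ * ρ < 1) (h : Expands M M' ρ) (hM : ∀ u, TrajBound M u (C * l2 u))
    (hβ : ∀ a, β a ∈ Set.Icc (0 : ℝ) 1) (a : ℕ → A) :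
    seqMatrix₂ γ β M' a = γ • (M' (a 0) * stepMatrix₂ γ β M' a) := by
  have hs := summable_smul_matProd hγ hρ hq h hM a (abs_coeff₂_le hγ hβ a)
  have hs' := summable_smul_matProd hγ hρ hq h hM (fun n => a (n + 1))
    (abs_coeff₂_le hγ hβ fun n => a (n + 1))
  rw [seqMatrix₂, hs.tsum_eq_zero_add]
  have : ∀ k, (γ ^ (k + 1 + 1) * (∏ i ∈ Finset.range (k + 1), (1 - β (a i))) * β (a (k + 1))) •
      matProd M' a (k + 1 + 1) = (γ * (1 - β (a 0))) • (M' (a 0) *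
        ((γ ^ (k + 1) * (∏ i ∈ Finset.range k, (1 - β (a (i + 1)))) * β (a (k + 1))) •
          matProd M' (fun n => a (n + 1)) (k + 1))) := fun k => by
    rw [matProd_succ', Finset.prod_range_succ', Matrix.mul_smul, smul_smul]
    congr 1
    ring
  simp only [this]
  rw [(hs'.mul_left (M' (a 0))).tsum_const_smul, hs'.tsum_mul_left, stepMatrix₂, seqMatrix₂]
  simp [matProd, mul_add, smul_smul]

/-- The fixed point equation satisfied by both families of step matrices, with offset `w = 1` and
`w = β` respectively. -/
def StepEq (γ : ℝ) (β w : A → ℝ) (M : A → Matrix (Fin d) (Fin d) ℝ)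
    (G : (ℕ → A) → Matrix (Fin d) (Fin d) ℝ) : Prop :=
  ∀ a, G a = w (a 0) • (1 : Matrix (Fin d) (Fin d) ℝ) +
    ((1 - β (a 0)) * γ) • (M (a 1) * G fun n => a (n + 1))

theorem stepEq₁ [Nonempty A] (hγ : 0 ≤ γ) (hρ : 0 ≤ ρ)
    (hq : γ * ρ < 1) (h : Expands M M' ρ) (hM : ∀ u, TrajBound M u (C * l2 u))
    (hβ : ∀ a, β a ∈ Set.Icc (0 : ℝ) 1) : StepEq γ β 1 M' (stepMatrix₁ γ β M') := fun a => by
  conv_lhs => rw [stepMatrix₁, seqMatrix₁_eq hγ hρ hq h hM hβ]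
  rw [smul_add, smul_smul, ← add_assoc, ← add_smul]
  simp

theorem stepEq₂ [Nonempty A] (hγ : 0 ≤ γ) (hρ : 0 ≤ ρ)
    (hq : γ * ρ < 1) (h : Expands M M' ρ) (hM : ∀ u, TrajBound M u (C * l2 u))
    (hβ : ∀ a, β a ∈ Set.Icc (0 : ℝ) 1) : StepEq γ β β M' (stepMatrix₂ γ β M') := fun a => by
  conv_lhs => rw [stepMatrix₂, seqMatrix₂_eq hγ hρ hq h hM hβ]
  rw [smul_smul]

/-- Crude a priori bounds, needed only to start the contraction argument. -/
theorem exists_stepMatrix_bound [Nonempty A] (hγ : 0 ≤ γ) (hρ : 0 ≤ ρ) (hC : 0 ≤ C)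
    (hq : γ * ρ < 1) (h : Expands M M' ρ) (hM : ∀ u, TrajBound M u (C * l2 u))
    (hβ : ∀ a, β a ∈ Set.Icc (0 : ℝ) 1) :
    ∃ K, 0 ≤ K ∧ ∀ u r a, TrajBound M u r →
      l2 (u ᵥ* stepMatrix₁ γ β M' a) ≤ K * r ∧ l2 (u ᵥ* stepMatrix₂ γ β M' a) ≤ K * r := by
  set T := ∑' k, C * (γ * ρ) ^ (k + 1) with hT
  have hT0 : 0 ≤ T := tsum_nonneg fun k => by positivity
  have hone : ∀ i j, |(1 : Matrix (Fin d) (Fin d) ℝ) i j| ≤ 1 := fun i j => by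
    rw [Matrix.one_apply]; split_ifs <;> simp
  have hmix : ∀ (b x y : ℝ), b ∈ Set.Icc (0 : ℝ) 1 → |x| ≤ 1 → |y| ≤ 1 + T →
      |b * x + (1 - b) * y| ≤ 1 + T := fun b x y hb hx hy => by
    rw [abs_le] at hx hy ⊢
    constructor <;> nlinarith [hb.1, hb.2]
  have hentry : ∀ (u : Fin d → ℝ) (r : ℝ) (W : Matrix (Fin d) (Fin d) ℝ), TrajBound M u r →
      (∀ i j, |W i j| ≤ 1 + T) → l2 (u ᵥ* W) ≤ (∑ _ : Fin d × Fin d, (1 + T)) * r := by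
    intro u r W hu hW
    refine (l2_vecMul_le u W).trans ?_
    rw [mul_comm]
    refine mul_le_mul ((l2_le_sum_abs _).trans (Finset.sum_le_sum fun q _ => hW _ _)) hu.l2_le
      (l2_nonneg _) (Finset.sum_nonneg fun _ _ => by positivity)
  refine ⟨∑ _ : Fin d × Fin d, (1 + T), Finset.sum_nonneg fun _ _ => by positivity,
    fun u r a hu => ⟨hentry _ _ _ hu fun i j => ?_, hentry _ _ _ hu fun i j => ?_⟩⟩
  · refine hmix _ _ _ (hβ (a 0)) (hone i j) ?_
    exact (abs_add_le _ _).trans (add_le_add (hone i j) (abs_tsum_smul_matProd_apply_le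
      hγ hρ hq h hM _ (abs_coeff₁_le hγ hβ _) i j))
  · refine hmix _ _ _ (hβ (a 0)) (hone i j) ?_
    exact (abs_tsum_smul_matProd_apply_le
      hγ hρ hq h hM _ (abs_coeff₂_le hγ hβ _) i j).trans (by linarith)

theorem continuous_featureMap [Nonempty A] [TopologicalSpace A] [DiscreteTopology A] {S : Type*}
    (φ : S × A → EuclideanSpace ℝ (Fin d)) (hγ : 0 ≤ γ) (hρ : 0 ≤ ρ)
    (hq : γ * ρ < 1) (h : Expands M M' ρ) (hM : ∀ u, TrajBound M u (C * l2 u))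
    (hβ : ∀ a, β a ∈ Set.Icc (0 : ℝ) 1) (s : S) : Continuous (featureMap φ γ β M' s) := by
  have hcoord : ∀ {X : Type _} [TopologicalSpace X] (f : A → X) (k : ℕ),
      Continuous fun a : ℕ → A => f (a k) :=
    fun f k => (continuous_of_discreteTopology (f := f)).comp (continuous_apply k)
  have hshift : Continuous fun (a : ℕ → A) n => a (n + 1) :=
    continuous_pi fun n => continuous_apply _
  have h1 : Continuous (seqMatrix₁ γ β M') := continuous_const.add
    (continuous_tsum_smul_matProd hγ hρ hq h hM
      (fun k => continuous_const.mul (continuous_prod_one_sub β k))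
      fun k a => abs_coeff₁_le hγ hβ a k)
  have h2 : Continuous (seqMatrix₂ γ β M') :=
    continuous_tsum_smul_matProd hγ hρ hq h hM
      (fun k => (continuous_const.mul (continuous_prod_one_sub β k)).mul (hcoord β k))
      fun k a => abs_coeff₂_le hγ hβ a k
  have g1 : Continuous (stepMatrix₁ γ β M') :=
    ((hcoord β 0).smul continuous_const).add
      ((continuous_const.sub (hcoord β 0)).smul (h1.comp hshift))
  have g2 : Continuous (stepMatrix₂ γ β M') :=
    ((hcoord β 0).smul continuous_const).add
      ((continuous_const.sub (hcoord β 0)).smul (h2.comp hshift))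
  have hφ : Continuous fun a : ℕ → A => (φ (s, a 0)).ofLp := hcoord (fun x => (φ (s, x)).ofLp) 0
  have : featureMap φ γ β M' s = fun a => WithLp.toLp 2 ((1 / 2 : ℝ) • Sum.elim
      ((1 - γ) • ((φ (s, a 0)).ofLp ᵥ* stepMatrix₁ γ β M' a))
      (γ • ((φ (s, a 0)).ofLp ᵥ* stepMatrix₂ γ β M' a))) := funext fun a => featureMap_eq φ s a
  have hsum : Continuous fun a => Sum.elim
      ((1 - γ) • ((φ (s, a 0)).ofLp ᵥ* stepMatrix₁ γ β M' a))
      (γ • ((φ (s, a 0)).ofLp ᵥ* stepMatrix₂ γ β M' a)) := by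
    refine continuous_pi ?_
    rintro (i | i)
    · exact (continuous_apply i).comp (Continuous.const_smul (hφ.matrix_vecMul g1) (1 - γ))
    · exact (continuous_apply i).comp (Continuous.const_smul (hφ.matrix_vecMul g2) γ)
  rw [this]
  exact (PiLp.continuous_toLp 2 _).comp (hsum.const_smul (1 / 2 : ℝ))

end Series

/-! ### Stability of the feature map -/

section Stability

variable {A : Type*} {d : ℕ} {M M' : A → Matrix (Fin d) (Fin d) ℝ} {γ δ η C W : ℝ}
  {β β' w w' : A → ℝ} {G G' : (ℕ → A) → Matrix (Fin d) (Fin d) ℝ}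

/-- Solutions of the fixed point equation are bounded in the trajectory norm by any constant that
is stable under the corresponding scalar equation. -/
theorem StepEq.l2_vecMul_le (hG : StepEq γ β w M G) (hγ0 : 0 ≤ γ) (hγ1 : γ < 1)
    (hβ : ∀ a, β a ∈ Set.Icc (0 : ℝ) 1) (hw : ∀ a, 0 ≤ w a) (hC : 0 ≤ C)
    (hCw : ∀ a, w a + (1 - β a) * γ * C ≤ C) {K : ℝ} (hK : 0 ≤ K) [Nonempty A]
    (hapriori : ∀ u r a, TrajBound M u r → l2 (u ᵥ* G a) ≤ K * r)
    {u : Fin d → ℝ} {r : ℝ} (hu : TrajBound M u r) (a : ℕ → A) :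
    l2 (u ᵥ* G a) ≤ C * r := by
  refine bound_of_contraction (e := fun u a => l2 (u ᵥ* G a)) hγ0 hγ1 hK
    (fun u r a hu => (hapriori u r a hu).trans ?_) (fun t ht hb u r a hu => ?_) hu a
  · nlinarith [hu.nonneg]
  · have hr := hu.nonneg
    have hb0 := hβ (a 0)
    have hc : 0 ≤ (1 - β (a 0)) * γ := mul_nonneg (sub_nonneg.2 hb0.2) hγ0
    have h1 := hb _ _ (fun n => a (n + 1)) (hu.vecMul (a 1))
    change l2 (u ᵥ* G a) ≤ _
    rw [hG a, Matrix.vecMul_add, Matrix.vecMul_smul, Matrix.vecMul_smul, Matrix.vecMul_one,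
      ← Matrix.vecMul_vecMul]
    refine (l2_add_le _ _).trans ?_
    rw [l2_smul, l2_smul, abs_of_nonneg (hw _), abs_of_nonneg hc]
    calc w (a 0) * l2 u + (1 - β (a 0)) * γ * l2 (u ᵥ* M (a 1) ᵥ* G fun n => a (n + 1))
        ≤ w (a 0) * r + (1 - β (a 0)) * γ * ((C + t) * r) :=
          add_le_add (mul_le_mul_of_nonneg_left hu.l2_le (hw _)) (mul_le_mul_of_nonneg_left h1 hc)
      _ = (w (a 0) + (1 - β (a 0)) * γ * C + (1 - β (a 0)) * (γ * t)) * r := by ring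
      _ ≤ (C + γ * t) * r := by
          refine mul_le_mul_of_nonneg_right (add_le_add (hCw _) ?_) hr
          exact mul_le_of_le_one_left (mul_nonneg hγ0 ht) (by linarith [hb0.1])

/-- Perturbation of the fixed point equation: the error is that of one step, divided by the
contraction gap `1 - γ (1 + δ)`. -/
theorem StepEq.l2_vecMul_sub_le [Nonempty A] (hG : StepEq γ β w M G) (hG' : StepEq γ β' w' M' G')
    (hγ0 : 0 ≤ γ) (hβ' : ∀ a, β' a ∈ Set.Icc (0 : ℝ) 1)
    (hβη : ∀ a, |β' a - β a| ≤ η) (hwW : ∀ a, |w' a - w a| ≤ W)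
    (hδ : 0 ≤ δ) (hq : γ * (1 + δ) < 1) (hC : 0 ≤ C)
    (hM' : ∀ u r a, TrajBound M u r → TrajBound M (u ᵥ* (M' a - M a)) (δ * r))
    (hGC : ∀ u r a, TrajBound M u r → l2 (u ᵥ* G a) ≤ C * r) {K : ℝ} (hK : 0 ≤ K)
    (hapriori : ∀ u r a, TrajBound M u r → l2 (u ᵥ* G' a) ≤ K * r)
    {u : Fin d → ℝ} {r : ℝ} (hu : TrajBound M u r) (a : ℕ → A) :
    l2 (u ᵥ* (G' a - G a)) ≤ (W + γ * (η + δ) * C) / (1 - γ * (1 + δ)) * r := by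
  have hη : 0 ≤ η := (abs_nonneg _).trans (hβη (a 0))
  have hW : 0 ≤ W := (abs_nonneg _).trans (hwW (a 0))
  set E := (W + γ * (η + δ) * C) / (1 - γ * (1 + δ)) with hE
  have hq' : 0 < 1 - γ * (1 + δ) := by linarith
  have hE0 : 0 ≤ E := by positivity
  have hEeq : W + γ * (η + δ) * C + γ * (1 + δ) * E = E := by
    have : E * (1 - γ * (1 + δ)) = W + γ * (η + δ) * C := div_mul_cancel₀ _ hq'.ne'
    linarith
  refine bound_of_contraction (e := fun u a => l2 (u ᵥ* (G' a - G a))) (K := K + C)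
    (by positivity) hq (by positivity) (fun u r a hu => ?_) (fun t ht hb u r a hu => ?_) hu a
  · rw [Matrix.vecMul_sub, sub_eq_add_neg]
    refine (l2_add_le _ _).trans ?_
    rw [l2_neg]
    have := add_le_add (hapriori u r a hu) (hGC u r a hu)
    nlinarith [hu.nonneg]
  · have hr := hu.nonneg
    set a' : ℕ → A := fun n => a (n + 1)
    have hb0 := hβ' (a 0)
    have e1 : u ᵥ* (G' a - G a) = (w' (a 0) - w (a 0)) • u +
        ((β (a 0) - β' (a 0)) * γ) • (u ᵥ* M (a 1) ᵥ* G a') +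
        ((1 - β' (a 0)) * γ) • (u ᵥ* (M' (a 1) - M (a 1)) ᵥ* G a' +
          u ᵥ* M' (a 1) ᵥ* (G' a' - G a')) := by
      rw [hG' a, hG a]
      simp only [Matrix.vecMul_sub, Matrix.vecMul_add, Matrix.sub_vecMul, Matrix.vecMul_smul,
        Matrix.vecMul_one, ← Matrix.vecMul_vecMul]
      module
    have i1 : l2 ((w' (a 0) - w (a 0)) • u) ≤ W * r := by
      rw [l2_smul]
      exact mul_le_mul (hwW _) hu.l2_le (l2_nonneg _) hW
    have i2 : l2 (((β (a 0) - β' (a 0)) * γ) • (u ᵥ* M (a 1) ᵥ* G a')) ≤ η * γ * (C * r) := by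
      rw [l2_smul, abs_mul, abs_of_nonneg hγ0, abs_sub_comm]
      exact mul_le_mul (mul_le_mul_of_nonneg_right (hβη _) hγ0) (hGC _ _ _ (hu.vecMul _))
        (l2_nonneg _) (by positivity)
    have i3 := hGC _ _ a' (hM' _ _ (a 1) hu)
    have i4 := hb _ _ a' (expands_of_sub hM' _ _ (a 1) hu)
    have hc : |(1 - β' (a 0)) * γ| ≤ γ := by
      rw [abs_of_nonneg (mul_nonneg (sub_nonneg.2 hb0.2) hγ0)]
      exact mul_le_of_le_one_left hγ0 (by linarith [hb0.1])
    have i5 : l2 (((1 - β' (a 0)) * γ) • (u ᵥ* (M' (a 1) - M (a 1)) ᵥ* G a' +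
        u ᵥ* M' (a 1) ᵥ* (G' a' - G a'))) ≤ γ * (C * (δ * r) + (E + t) * ((1 + δ) * r)) := by
      rw [l2_smul]
      exact mul_le_mul hc ((l2_add_le _ _).trans (add_le_add i3 i4)) (l2_nonneg _) hγ0
    change l2 (u ᵥ* (G' a - G a)) ≤ _
    rw [e1]
    refine (l2_add_le _ _).trans
      ((add_le_add ((l2_add_le _ _).trans (add_le_add i1 i2)) i5).trans (le_of_eq ?_))
    linear_combination r * hEeq

/-- The deterministic core: estimates of the action-matrices and burst probabilities that are
accurate to order `ε (1 - γ)` give a feature map accurate to `ε / 2`, which becomes admissible after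
division by `1 + ε / 2`. -/
theorem isAdmissible_of_close [Nonempty A] [TopologicalSpace A] [DiscreteTopology A] {S : Type*}
    {φ : S × A → EuclideanSpace ℝ (Fin d)} {C₀ ε : ℝ} (hγ0 : 0 < γ) (hγ1 : γ < 1)
    (hφ : ∀ s a, TrajBound M (φ (s, a)).ofLp 1)
    (hC₀ : 0 ≤ C₀) (hM : ∀ u, TrajBound M u (C₀ * l2 u))
    (hβ : ∀ a, β a ∈ Set.Icc (0 : ℝ) 1) (hβ' : ∀ a, β' a ∈ Set.Icc (0 : ℝ) 1)
    (hε0 : 0 < ε) (hε1 : ε < 1) (hβη : ∀ a, |β' a - β a| ≤ ε * (1 - γ) / 64)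
    (hM' : ∀ u r a, TrajBound M u r →
      TrajBound M (u ᵥ* (M' a - M a)) (ε * (1 - γ) / 64 * r)) :
    IsAdmissible ε (featureMap φ γ β M)
      fun s a => (1 + ε / 2)⁻¹ • featureMap φ γ β' M' s a := by
  set δ := ε * (1 - γ) / 64 with hδ
  have h1γ : 0 < 1 - γ := by linarith
  have hδ0 : 0 ≤ δ := by positivity
  have hδ1 : δ ≤ (1 - γ) / 64 := by rw [hδ]; gcongr; nlinarith
  have hgap : (1 - γ) / 2 ≤ 1 - γ * (1 + δ) := by nlinarith
  have hq : γ * (1 + δ) < 1 := by linarith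
  have hexp := expands_of_sub hM'
  obtain ⟨K, hK, hKb⟩ := exists_stepMatrix_bound hγ0.le zero_le_one hC₀ (by linarith)
    expands_self hM hβ
  obtain ⟨K', hK', hKb'⟩ := exists_stepMatrix_bound hγ0.le (by linarith) hC₀ hq hexp hM hβ'
  have s1 := stepEq₁ hγ0.le zero_le_one (by linarith) expands_self hM hβ
  have s2 := stepEq₂ hγ0.le zero_le_one (by linarith) expands_self hM hβ
  have s1' := stepEq₁ hγ0.le (by linarith) hq hexp hM hβ'
  have s2' := stepEq₂ hγ0.le (by linarith) hq hexp hM hβ'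
  have b1 : ∀ u r a, TrajBound M u r → l2 (u ᵥ* stepMatrix₁ γ β M a) ≤ (1 - γ)⁻¹ * r :=
    fun u r a hu => s1.l2_vecMul_le hγ0.le hγ1 hβ (fun _ => zero_le_one) (by positivity)
      (fun a => by
        have h : γ * (1 - γ)⁻¹ = (1 - γ)⁻¹ - 1 := by field_simp; ring
        have h0 : 0 ≤ γ * (1 - γ)⁻¹ := by positivity
        rw [mul_assoc, Pi.one_apply]
        nlinarith [(hβ a).1])
      hK (fun u r a hu => (hKb u r a hu).1) hu a
  have b2 : ∀ u r a, TrajBound M u r → l2 (u ᵥ* stepMatrix₂ γ β M a) ≤ 1 * r :=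
    fun u r a hu => s2.l2_vecMul_le hγ0.le hγ1 hβ (fun a => (hβ a).1) zero_le_one
      (fun a => by nlinarith [(hβ a).2]) hK (fun u r a hu => (hKb u r a hu).2) hu a
  have d1 : ∀ s a, (1 - γ) * l2 ((φ (s, a 0)).ofLp ᵥ* (stepMatrix₁ γ β' M' a - stepMatrix₁ γ β M a))
      ≤ ε / 16 := fun s a => by
    have := s1.l2_vecMul_sub_le s1' hγ0.le hβ' hβη (W := 0) (by simp) hδ0 hq (by positivity) hM' b1
      hK' (fun u r a hu => (hKb' u r a hu).1) (hφ s (a 0)) a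
    rw [zero_add, mul_one] at this
    have h2 : γ * (δ + δ) * (1 - γ)⁻¹ / (1 - γ * (1 + δ)) ≤ (δ + δ) * (1 - γ)⁻¹ / ((1 - γ) / 2) := by
      refine div_le_div₀ (by positivity) ?_ (by positivity) hgap
      refine mul_le_mul_of_nonneg_right ?_ (by positivity)
      exact mul_le_of_le_one_left (by positivity) hγ1.le
    refine (mul_le_mul_of_nonneg_left (this.trans h2) h1γ.le).trans (le_of_eq ?_)
    rw [hδ]; field_simp; ring
  have d2 : ∀ s a, γ * l2 ((φ (s, a 0)).ofLp ᵥ* (stepMatrix₂ γ β' M' a - stepMatrix₂ γ β M a))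
      ≤ 3 * ε / 32 := fun s a => by
    have := s2.l2_vecMul_sub_le s2' hγ0.le hβ' hβη hβη hδ0 hq zero_le_one hM' b2
      hK' (fun u r a hu => (hKb' u r a hu).2) (hφ s (a 0)) a
    rw [mul_one, mul_one] at this
    have h2 : (δ + γ * (δ + δ)) / (1 - γ * (1 + δ)) ≤ (3 * δ) / ((1 - γ) / 2) := by
      refine div_le_div₀ (by positivity) ?_ (by positivity) hgap
      nlinarith
    refine (mul_le_of_le_one_left (l2_nonneg _) hγ1.le).trans ((this.trans h2).trans (le_of_eq ?_))
    rw [hδ]; field_simp; ring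
  have hdiff : ∀ s a, ‖featureMap φ γ β' M' s a - featureMap φ γ β M s a‖ ≤ ε / 2 := fun s a => by
    have e : featureMap φ γ β' M' s a - featureMap φ γ β M s a =
        WithLp.toLp 2 ((1 / 2 : ℝ) • Sum.elim
        ((1 - γ) • ((φ (s, a 0)).ofLp ᵥ* (stepMatrix₁ γ β' M' a - stepMatrix₁ γ β M a)))
        (γ • ((φ (s, a 0)).ofLp ᵥ* (stepMatrix₂ γ β' M' a - stepMatrix₂ γ β M a)))) := by
      rw [featureMap_eq, featureMap_eq, ← WithLp.toLp_sub]
      congr 1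
      ext (i | i) <;> simp [Matrix.vecMul_sub] <;> ring
    rw [e]
    change l2 _ ≤ _
    have h := l2_sumElim_le
      ((1 - γ) • ((φ (s, a 0)).ofLp ᵥ* (stepMatrix₁ γ β' M' a - stepMatrix₁ γ β M a)))
      (γ • ((φ (s, a 0)).ofLp ᵥ* (stepMatrix₂ γ β' M' a - stepMatrix₂ γ β M a)))
    rw [l2_smul, l2_smul, abs_of_pos h1γ, abs_of_pos hγ0] at h
    rw [l2_smul, abs_of_pos (by norm_num)]
    linarith [d1 s a, d2 s a]
  have hnorm : ∀ s a, ‖featureMap φ γ β M s a‖ ≤ 1 := fun s a => by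
    rw [featureMap_eq]
    change l2 _ ≤ _
    have h := l2_sumElim_le ((1 - γ) • ((φ (s, a 0)).ofLp ᵥ* stepMatrix₁ γ β M a))
      (γ • ((φ (s, a 0)).ofLp ᵥ* stepMatrix₂ γ β M a))
    rw [l2_smul, l2_smul, abs_of_pos h1γ, abs_of_pos hγ0] at h
    rw [l2_smul, abs_of_pos (by norm_num)]
    have h1 := mul_le_mul_of_nonneg_left (b1 _ _ a (hφ s (a 0))) h1γ.le
    have h2 := mul_le_mul_of_nonneg_left (b2 _ _ a (hφ s (a 0))) hγ0.le
    rw [mul_one, mul_inv_cancel₀ h1γ.ne'] at h1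
    linarith
  have hc : 0 < 1 + ε / 2 := by positivity
  refine ⟨fun s a => ?_, fun s a => ?_, fun s => ?_⟩
  · have e : (1 + ε / 2)⁻¹ • featureMap φ γ β' M' s a - featureMap φ γ β M s a =
        (1 + ε / 2)⁻¹ • ((featureMap φ γ β' M' s a - featureMap φ γ β M s a) -
          (ε / 2) • featureMap φ γ β M s a) := by
      rw [sub_sub, smul_sub]
      congr 1
      rw [show featureMap φ γ β M s a + (ε / 2) • featureMap φ γ β M s a =
        (1 + ε / 2) • featureMap φ γ β M s a by module, smul_smul, inv_mul_cancel₀ hc.ne', one_smul]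
    rw [e, norm_smul, norm_inv, Real.norm_eq_abs, abs_of_pos hc, inv_mul_le_iff₀ hc]
    refine (norm_sub_le _ _).trans ?_
    rw [norm_smul, Real.norm_eq_abs, abs_of_pos (by positivity : (0 : ℝ) < ε / 2)]
    nlinarith [hdiff s a, hnorm s a]
  · rw [norm_smul, norm_inv, Real.norm_eq_abs, abs_of_pos hc, inv_mul_le_iff₀ hc, mul_one]
    have := norm_add_le (featureMap φ γ β M s a)
      (featureMap φ γ β' M' s a - featureMap φ γ β M s a)
    rw [add_sub_cancel] at this
    linarith [hdiff s a, hnorm s a]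
  · have hρ : 0 ≤ 1 + δ := by linarith
    exact Continuous.const_smul (continuous_featureMap φ hγ0.le hρ hq hexp hM hβ' s) (1 + ε / 2)⁻¹

end Stability

/-! ### Action-matrices of a linear model -/

section Model

variable {S A : Type*} [MeasurableSpace S] [MeasurableSpace A] {𝓜 : MDP S A} {d : ℕ}

/-- The integral of a real function against a signed measure. The pairing is the one with which
`LinearModel.actionMatrix` is defined. -/
noncomputable def signedIntegral (ν : SignedMeasure S) (f : S → ℝ) : ℝ :=
  ν.integral f (ContinuousLinearMap.lsmul ℝ ℝ).flip

theorem integrable_variation (ν : SignedMeasure S) {f : S → ℝ} (hf : Measurable f) {C : ℝ}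
    (hC : ∀ s, |f s| ≤ C) : ν.Integrable f := by
  have : IsFiniteMeasure ν.variation := by
    rw [← SignedMeasure.totalVariation_eq_variation]; infer_instance
  exact Integrable.of_bound hf.aestronglyMeasurable C (Filter.Eventually.of_forall hC)

theorem abs_signedIntegral_le (ν : SignedMeasure S) {f : S → ℝ} (hf : Measurable f) {C : ℝ}
    (hC : ∀ s, |f s| ≤ C) :
    |signedIntegral ν f| ≤ (ν.totalVariation Set.univ).toReal * C := by
  have hfin : IsFiniteMeasure ν.variation := by
    rw [← SignedMeasure.totalVariation_eq_variation]; infer_instance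
  have h1 : |signedIntegral ν f| ≤ ‖(ContinuousLinearMap.lsmul ℝ ℝ (E := ℝ)).flip‖ *
      ∫ a, ‖f a‖ ∂ν.variation := by
    rw [← Real.norm_eq_abs]
    exact VectorMeasure.norm_integral_le_integral_norm
  have h2 : ‖(ContinuousLinearMap.lsmul ℝ ℝ (E := ℝ)).flip‖ ≤ 1 := by
    rw [ContinuousLinearMap.opNorm_flip]
    exact ContinuousLinearMap.opNorm_lsmul_le
  have h3 : ∫ a, ‖f a‖ ∂ν.variation ≤ (ν.totalVariation Set.univ).toReal * C := by
    rw [SignedMeasure.totalVariation_eq_variation]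
    have := integral_mono (μ := ν.variation) (integrable_variation ν hf hC).norm
      (integrable_const C) hC
    simpa [measureReal_def] using this
  have h0 : 0 ≤ ∫ a, ‖f a‖ ∂ν.variation := integral_nonneg fun _ => norm_nonneg _
  exact h1.trans ((mul_le_of_le_one_left h0 h2).trans h3)

theorem signedIntegral_sum_mul (ν : SignedMeasure S) (x : Fin d → ℝ) {f : Fin d → S → ℝ}
    (hf : ∀ j, Measurable (f j)) {C : ℝ} (hC : ∀ j s, |f j s| ≤ C) :
    ∑ j, signedIntegral ν (f j) * x j = signedIntegral ν fun s => ∑ j, f j s * x j := by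
  unfold signedIntegral
  rw [VectorMeasure.integral_finsetSum]
  · refine Finset.sum_congr rfl fun j _ => ?_
    simp only [mul_comm _ (x j), ← smul_eq_mul]
    rw [VectorMeasure.integral_fun_smul]
  · intro j _
    exact (integrable_variation ν (hf j) (hC j)).mul_const _

namespace LinearModel

variable (L : LinearModel 𝓜 d)

theorem abs_φ_le (s : S) (a : A) (j : Fin d) : |L.φ (s, a) j| ≤ 1 := by
  have := PiLp.norm_apply_le (L.φ (s, a)) j
  exact this.trans (L.norm_φ_le s a)

theorem measurable_φ_apply (j : Fin d) : Measurable fun z => L.φ z j :=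
  (EuclideanSpace.proj (𝕜 := ℝ) j).continuous.measurable.comp L.φ_measurable

theorem measurable_φ_left (a : A) (j : Fin d) : Measurable fun s => L.φ (s, a) j :=
  (L.measurable_φ_apply j).comp measurable_prodMk_right

/-- The linear representation of the transition kernel extends from events to bounded functions. -/
theorem sum_φ_mul_signedIntegral (s : S) (a : A) {f : S → ℝ} (hf : Measurable f) {C : ℝ}
    (hC : ∀ s, |f s| ≤ C) :
    ∑ i, L.φ (s, a) i * signedIntegral (L.μ i) f = ∫ s', f s' ∂𝓜.P (s, a) := by
  have h : ∑ i, L.φ (s, a) i • L.μ i = (𝓜.P (s, a)).toSignedMeasure := by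
    ext B hB
    rw [Measure.toSignedMeasure_apply_measurable hB, L.transition s a B hB]
    simp
  rw [← VectorMeasure.integral_toSignedMeasure, ← h,
    VectorMeasure.integral_finsetSum_vectorMeasure fun i _ =>
      (integrable_variation (L.μ i) hf hC).smul_vectorMeasure _]
  simp [signedIntegral]

/-- `⟨u M(a), x⟩ = ∑ᵢ uᵢ ∫ ⟨φ(s, a), x⟩ μᵢ(ds)`. -/
theorem vecMul_actionMatrix_dotProduct (u x : Fin d → ℝ) (a : A) :
    (u ᵥ* L.actionMatrix a) ⬝ᵥ x =
      ∑ i, u i * signedIntegral (L.μ i) fun s => (L.φ (s, a)).ofLp ⬝ᵥ x := by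
  rw [← Matrix.dotProduct_mulVec]
  refine Finset.sum_congr rfl fun i _ => ?_
  congr 1
  exact signedIntegral_sum_mul (L.μ i) x (fun j => L.measurable_φ_left a j)
    fun j s => L.abs_φ_le s a j

theorem measurable_φ_dotProduct (a : A) (x : Fin d → ℝ) :
    Measurable fun s => (L.φ (s, a)).ofLp ⬝ᵥ x :=
  Finset.measurable_fun_sum _ fun j _ => (L.measurable_φ_left a j).mul_const _

theorem l2_φ_le (s : S) (a : A) : l2 (L.φ (s, a)).ofLp ≤ 1 := L.norm_φ_le s a

theorem abs_φ_dotProduct_le (s : S) (a : A) (x : Fin d → ℝ) :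
    |(L.φ (s, a)).ofLp ⬝ᵥ x| ≤ l2 x :=
  (abs_dotProduct_le _ _).trans (mul_le_of_le_one_left (l2_nonneg _) (L.l2_φ_le s a))

/-- The conditional expectation of the next feature is linear in the current one. -/
theorem φ_vecMul_actionMatrix_dotProduct (s : S) (a a' : A) (x : Fin d → ℝ) :
    ((L.φ (s, a)).ofLp ᵥ* L.actionMatrix a') ⬝ᵥ x =
      ∫ s', (L.φ (s', a')).ofLp ⬝ᵥ x ∂𝓜.P (s, a) := by
  rw [vecMul_actionMatrix_dotProduct, L.sum_φ_mul_signedIntegral s a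
    (L.measurable_φ_dotProduct a' x) fun s' => L.abs_φ_dotProduct_le s' a' x]

theorem φ_vecMul_actionMatrix_apply (s : S) (a a' : A) (j : Fin d) :
    ((L.φ (s, a)).ofLp ᵥ* L.actionMatrix a') j = ∫ s', L.φ (s', a') j ∂𝓜.P (s, a) := by
  simpa using L.φ_vecMul_actionMatrix_dotProduct s a a' (Pi.single j 1)

/-- Along a trajectory, `φ(s, a) M(a₁) ⋯ M(aₖ)` is an expected feature, hence of norm at most `1`. -/
theorem trajBound_φ (s : S) (a : A) : TrajBound L.actionMatrix (L.φ (s, a)).ofLp 1 := by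
  intro k
  induction k generalizing s a with
  | zero => intro b; simpa [matProd] using L.l2_φ_le s a
  | succ k ih =>
    intro b
    rw [matProd_succ', ← Matrix.vecMul_vecMul]
    refine l2_le_of_forall_dotProduct_le zero_le_one fun w => ?_
    rw [← Matrix.dotProduct_mulVec, L.φ_vecMul_actionMatrix_dotProduct]
    have h : ∀ s', (L.φ (s', b 0)).ofLp ⬝ᵥ matProd L.actionMatrix (fun n => b (n + 1)) k *ᵥ w ≤
        1 * l2 w := fun s' => by
      rw [Matrix.dotProduct_mulVec]
      exact (le_abs_self _).trans ((abs_dotProduct_le _ _).trans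
        (mul_le_mul_of_nonneg_right (ih s' (b 0) _) (l2_nonneg _)))
    refine (integral_mono (Integrable.of_bound
      (L.measurable_φ_dotProduct _ _).aestronglyMeasurable _ (Filter.Eventually.of_forall
        fun s' => L.abs_φ_dotProduct_le s' _ _)) (integrable_const _) h).trans ?_
    simp

/-- Under the normalization of `μ`, the trajectory norm exceeds the Euclidean one by a factor of at
most `√d`. -/
theorem trajBound_of_l2 (u : Fin d → ℝ) : TrajBound L.actionMatrix u (√d * l2 u) := by
  intro k b
  rcases Nat.eq_zero_or_pos d with rfl | hd
  · have : l2 (u ᵥ* matProd L.actionMatrix b k) = 0 := by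
      rw [Subsingleton.elim (u ᵥ* matProd L.actionMatrix b k) 0, l2_zero]
    rw [this]
    positivity [l2_nonneg u]
  · cases k with
    | zero =>
      simp only [matProd, Matrix.vecMul_one]
      refine le_mul_of_one_le_left (l2_nonneg u) ?_
      rw [Real.one_le_sqrt]
      exact_mod_cast hd
    | succ k =>
      rw [matProd_succ', ← Matrix.vecMul_vecMul]
      refine l2_le_of_forall_dotProduct_le (mul_nonneg (Real.sqrt_nonneg _) (l2_nonneg u))
        fun w => ?_
      rw [← Matrix.dotProduct_mulVec, L.vecMul_actionMatrix_dotProduct]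
      have h : ∀ i, |signedIntegral (L.μ i) fun s => (L.φ (s, b 0)).ofLp ⬝ᵥ
          matProd L.actionMatrix (fun n => b (n + 1)) k *ᵥ w| ≤
          ((L.μ i).totalVariation Set.univ).toReal * l2 w := fun i => by
        refine abs_signedIntegral_le _ (L.measurable_φ_dotProduct _ _) fun s => ?_
        rw [Matrix.dotProduct_mulVec]
        exact (abs_dotProduct_le _ _).trans
          (mul_le_of_le_one_left (l2_nonneg _) (L.trajBound_φ s (b 0) _ _))
      calc _ ≤ ∑ i, |u i| * (((L.μ i).totalVariation Set.univ).toReal * l2 w) := by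
            refine Finset.sum_le_sum fun i _ => (le_abs_self _).trans ?_
            rw [abs_mul]
            exact mul_le_mul_of_nonneg_left (h i) (abs_nonneg _)
        _ = ((fun i => |u i|) ⬝ᵥ fun i => ((L.μ i).totalVariation Set.univ).toReal) * l2 w := by
            rw [dotProduct, Finset.sum_mul]
            exact Finset.sum_congr rfl fun i _ => by ring
        _ ≤ √d * l2 u * l2 w := by
            refine mul_le_mul_of_nonneg_right ?_ (l2_nonneg w)
            refine (le_abs_self _).trans ((abs_dotProduct_le _ _).trans ?_)
            have e : l2 (fun i => |u i|) = l2 u := by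
              rw [← sq_eq_sq₀ (l2_nonneg _) (l2_nonneg _), l2_sq, l2_sq]
              simp
            rw [e, mul_comm]
            exact mul_le_mul_of_nonneg_right L.norm_μ_le (l2_nonneg u)

end LinearModel

end Model

/-! ### Concentration for sums of independent bounded vectors -/

section Concentration

/-- `cosh ∘ √` is convex on `[0, ∞)`, because its power series there has nonnegative coefficients. -/
theorem cosh_sqrt_le {x y a b : ℝ} (hx : 0 ≤ x) (hy : 0 ≤ y) (ha : 0 ≤ a) (hb : 0 ≤ b)
    (hab : a + b = 1) :
    Real.cosh √(a * x + b * y) ≤ a * Real.cosh √x + b * Real.cosh √y := by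
  have hs : ∀ z : ℝ, 0 ≤ z → HasSum (fun n : ℕ => z ^ n / ((2 * n).factorial : ℝ))
      (Real.cosh √z) := fun z hz => by
    have := Real.hasSum_cosh √z
    simpa only [pow_mul, Real.sq_sqrt hz] using this
  refine hasSum_le (fun n => ?_) (hs _ (by positivity))
    (((hs x hx).mul_left a).add ((hs y hy).mul_left b))
  rw [← mul_div_assoc, ← mul_div_assoc, ← add_div]
  gcongr
  have := (convexOn_pow n).2 (x := x) (y := y) hx hy ha hb hab
  simpa using this

variable {E : Type*} [NormedAddCommGroup E] [InnerProductSpace ℝ E]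

/-- A step `z` with `‖z‖ ≤ B` increases `cosh ‖x‖` by the factor `cosh B`, up to a term that is
linear in `z`. -/
theorem cosh_norm_add_le {B : ℝ} (hB : 0 < B) (x : E) :
    ∃ κ : ℝ, ∀ z : E, ‖z‖ ≤ B →
      Real.cosh ‖x + z‖ ≤ Real.cosh ‖x‖ * Real.cosh B + κ * inner ℝ x z := by
  rcases eq_or_ne x 0 with rfl | hx
  · refine ⟨0, fun z hz => ?_⟩
    simpa [Real.cosh_le_cosh, abs_of_pos hB] using hz
  · have hx0 : 0 < ‖x‖ := norm_pos_iff.2 hx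
    refine ⟨Real.sinh ‖x‖ * Real.sinh B / (‖x‖ * B), fun z hz => ?_⟩
    set t := inner ℝ x z / (‖x‖ * B) with ht
    have hin : |inner ℝ x z| ≤ ‖x‖ * B :=
      (abs_real_inner_le_norm x z).trans (mul_le_mul_of_nonneg_left hz hx0.le)
    have hpos : 0 < ‖x‖ * B := by positivity
    have hint : inner ℝ x z = t * (‖x‖ * B) := (div_mul_cancel₀ _ hpos.ne').symm
    have ht1 : |t| ≤ 1 := by
      rw [ht, abs_div, abs_of_pos hpos]
      exact div_le_one_of_le₀ hin hpos.le
    rw [abs_le] at ht1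
    -- `‖x + z‖² ≤ ‖x‖² + B² + 2⟨x, z⟩` lies on the chord between `(‖x‖ ± B)²`.
    have hsq : ‖x + z‖ ^ 2 ≤ (1 + t) / 2 * (‖x‖ + B) ^ 2 + (1 - t) / 2 * (‖x‖ - B) ^ 2 := by
      rw [norm_add_sq_real, hint]
      nlinarith [norm_nonneg z]
    have hle : ‖x + z‖ ≤ √((1 + t) / 2 * (‖x‖ + B) ^ 2 + (1 - t) / 2 * (‖x‖ - B) ^ 2) :=
      Real.le_sqrt_of_sq_le hsq
    have h1 : Real.cosh ‖x + z‖ ≤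
        Real.cosh √((1 + t) / 2 * (‖x‖ + B) ^ 2 + (1 - t) / 2 * (‖x‖ - B) ^ 2) := by
      rwa [Real.cosh_le_cosh, abs_of_nonneg (norm_nonneg _), abs_of_nonneg (Real.sqrt_nonneg _)]
    have h2 := cosh_sqrt_le (sq_nonneg (‖x‖ + B)) (sq_nonneg (‖x‖ - B))
      (by linarith : 0 ≤ (1 + t) / 2) (by linarith : 0 ≤ (1 - t) / 2) (by ring)
    rw [Real.sqrt_sq_eq_abs, Real.sqrt_sq_eq_abs, Real.cosh_abs, Real.cosh_abs, Real.cosh_add,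
      Real.cosh_sub] at h2
    have h3 : Real.sinh ‖x‖ * Real.sinh B / (‖x‖ * B) * inner ℝ x z =
        t * (Real.sinh ‖x‖ * Real.sinh B) := by
      rw [ht]; ring
    rw [h3]
    linarith

variable [FiniteDimensional ℝ E] [MeasurableSpace E] [BorelSpace E]
  {Ω : Type*} [MeasurableSpace Ω] {P : Measure Ω} [IsProbabilityMeasure P]

/-- Adding an independent centred step to a random walk multiplies `𝔼 cosh ‖X‖` by at most
`cosh B`. -/
theorem integral_cosh_norm_add_le {B R : ℝ} (hB : 0 < B) {X Z : Ω → E} (hX : Measurable X)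
    (hZ : Measurable Z) (hXZ : X ⟂ᵢ[P] Z) (hXb : ∀ ω, ‖X ω‖ ≤ R) (hZb : ∀ ω, ‖Z ω‖ ≤ B)
    (hmean : ∫ ω, Z ω ∂P = 0) :
    ∫ ω, Real.cosh ‖X ω + Z ω‖ ∂P ≤ (∫ ω, Real.cosh ‖X ω‖ ∂P) * Real.cosh B := by
  have : CompleteSpace E := FiniteDimensional.complete ℝ E
  have : SecondCountableTopology E := by
    have := FiniteDimensional.proper_real E
    infer_instance
  have hR : ∀ y : E, ‖y‖ ≤ R → ∀ z : E, ‖z‖ ≤ B → ‖Real.cosh ‖y + z‖‖ ≤ Real.cosh (R + B) := by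
    intro y hy z hz
    rw [Real.norm_eq_abs, abs_of_pos (Real.cosh_pos _), Real.cosh_le_cosh,
      abs_of_nonneg (norm_nonneg _)]
    exact ((norm_add_le _ _).trans (add_le_add hy hz)).trans (le_abs_self _)
  have hmeas : Measurable fun q : E × E => Real.cosh ‖q.1 + q.2‖ :=
    Real.measurable_cosh.comp (measurable_fst.add measurable_snd).norm
  have := Measure.isProbabilityMeasure_map (μ := P) hX.aemeasurable
  have := Measure.isProbabilityMeasure_map (μ := P) hZ.aemeasurable
  have hXb' : ∀ᵐ x ∂P.map X, ‖x‖ ≤ R :=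
    (ae_map_iff hX.aemeasurable (measurableSet_le measurable_norm measurable_const)).2
      (Filter.Eventually.of_forall hXb)
  have hZb' : ∀ᵐ z ∂P.map Z, ‖z‖ ≤ B :=
    (ae_map_iff hZ.aemeasurable (measurableSet_le measurable_norm measurable_const)).2
      (Filter.Eventually.of_forall hZb)
  have hlaw := (indepFun_iff_map_prod_eq_prod_map_map hX.aemeasurable hZ.aemeasurable).1 hXZ
  have hint : Integrable (fun q : E × E => Real.cosh ‖q.1 + q.2‖) ((P.map X).prod (P.map Z)) := by
    refine Integrable.of_bound hmeas.aestronglyMeasurable (Real.cosh (R + B)) ?_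
    rw [← hlaw, ae_map_iff (hX.prodMk hZ).aemeasurable
      (measurableSet_le hmeas.norm measurable_const)]
    exact Filter.Eventually.of_forall fun ω => hR _ (hXb ω) _ (hZb ω)
  have e1 : ∫ ω, Real.cosh ‖X ω + Z ω‖ ∂P =
      ∫ x, ∫ z, Real.cosh ‖x + z‖ ∂P.map Z ∂P.map X := by
    rw [← integral_prod _ hint, ← hlaw,
      integral_map (hX.prodMk hZ).aemeasurable hmeas.aestronglyMeasurable]
  have hcm : Measurable fun x : E => Real.cosh ‖x‖ := Real.measurable_cosh.comp measurable_norm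
  have e2 : ∫ ω, Real.cosh ‖X ω‖ ∂P = ∫ x, Real.cosh ‖x‖ ∂P.map X := by
    rw [integral_map hX.aemeasurable hcm.aestronglyMeasurable]
  have hZint : Integrable (fun z => z) (P.map Z) :=
    Integrable.of_bound measurable_id.aestronglyMeasurable B hZb'
  have hZmean : ∫ z, z ∂P.map Z = 0 := by
    rw [← hmean]
    exact integral_map hZ.aemeasurable measurable_id.aestronglyMeasurable
  rw [e1, e2, ← integral_mul_const]
  refine integral_mono_ae hint.integral_prod_left ((Integrable.of_bound hcm.aestronglyMeasurable
    (Real.cosh R) ?_).mul_const _) (Filter.Eventually.of_forall fun x => ?_)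
  · filter_upwards [hXb'] with x hx
    rw [Real.norm_eq_abs, abs_of_pos (Real.cosh_pos _), Real.cosh_le_cosh,
      abs_of_nonneg (norm_nonneg _)]
    exact hx.trans (le_abs_self _)
  · obtain ⟨κ, hκ⟩ := cosh_norm_add_le hB x
    have hin : Integrable (fun z => κ * inner ℝ x z) (P.map Z) :=
      (hZint.const_inner x).const_mul κ
    calc ∫ z, Real.cosh ‖x + z‖ ∂P.map Z
        ≤ ∫ z, (Real.cosh ‖x‖ * Real.cosh B + κ * inner ℝ x z) ∂P.map Z := by
          refine integral_mono_of_nonneg (Filter.Eventually.of_forall fun z => (Real.cosh_pos _).le)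
            ((integrable_const _).add hin) ?_
          filter_upwards [hZb'] with z hz using hκ z hz
      _ = Real.cosh ‖x‖ * Real.cosh B := by
          have h0 : ∫ z, κ * inner ℝ x z ∂P.map Z = 0 := by
            rw [integral_const_mul, integral_inner hZint, hZmean, inner_zero_right, mul_zero]
          rw [integral_add (integrable_const _) hin, h0]
          simp

/-- Dimension-free Hoeffding inequality in Euclidean space, in the unoptimized form
`P(‖∑ Zₙ‖ ≥ t) ≤ 2 exp(N B² / 2 - t)`. -/
theorem measure_norm_sum_ge_le_exp_sub {ι : Type*} [Fintype ι] {B : ℝ} (hB : 0 < B) {Z : ι → Ω → E}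
    (hZ : ∀ i, Measurable (Z i)) (hind : iIndepFun Z P) (hZb : ∀ i ω, ‖Z i ω‖ ≤ B)
    (hmean : ∀ i, ∫ ω, Z i ω ∂P = 0) (t : ℝ) :
    P.real {ω | t ≤ ‖∑ i, Z i ω‖} ≤ 2 * Real.exp (Fintype.card ι * (B ^ 2 / 2) - t) := by
  classical
  have hsumb : ∀ (s : Finset ι) ω, ‖∑ i ∈ s, Z i ω‖ ≤ s.card * B := fun s ω => by
    refine (norm_sum_le _ _).trans ((Finset.sum_le_sum fun i _ => hZb i ω).trans ?_)
    simp
  have hsumm : ∀ s : Finset ι, Measurable fun ω => ∑ i ∈ s, Z i ω := fun s =>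
    Finset.measurable_fun_sum s fun i _ => hZ i
  have key : ∀ s : Finset ι, ∫ ω, Real.cosh ‖∑ i ∈ s, Z i ω‖ ∂P ≤ Real.cosh B ^ s.card := by
    intro s
    induction s using Finset.induction_on with
    | empty => simp
    | insert i s hi ih =>
      have hI := hind.indepFun_finsetSum_of_notMem hZ hi
      have hI' : (fun ω => ∑ j ∈ s, Z j ω) ⟂ᵢ[P] Z i := by
        convert hI using 1
        ext ω
        simp
      have := integral_cosh_norm_add_le hB (hsumm s) (hZ i) hI' (hsumb s) (hZb i) (hmean i)
      rw [Finset.card_insert_of_notMem hi, pow_succ]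
      simp only [Finset.sum_insert hi]
      simp only [add_comm (Z i _)]
      exact this.trans (mul_le_mul_of_nonneg_right ih (Real.cosh_pos _).le)
  have hcm : Measurable fun ω => Real.cosh ‖∑ i, Z i ω‖ :=
    Real.measurable_cosh.comp (hsumm Finset.univ).norm
  have hint : Integrable (fun ω => Real.cosh ‖∑ i, Z i ω‖) P := by
    refine Integrable.of_bound hcm.aestronglyMeasurable
      (Real.cosh ((Finset.univ : Finset ι).card * B)) (Filter.Eventually.of_forall fun ω => ?_)
    rw [Real.norm_eq_abs, abs_of_pos (Real.cosh_pos _), Real.cosh_le_cosh,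
      abs_of_nonneg (norm_nonneg _)]
    exact (hsumb _ ω).trans (le_abs_self _)
  have hmk := mul_meas_ge_le_integral_of_nonneg (μ := P)
    (Filter.Eventually.of_forall fun ω => (Real.cosh_pos _).le) hint (Real.exp t / 2)
  have hsub : {ω | t ≤ ‖∑ i, Z i ω‖} ⊆ {ω | Real.exp t / 2 ≤ Real.cosh ‖∑ i, Z i ω‖} := by
    intro ω hω
    simp only [Set.mem_ofPred_eq] at hω ⊢
    rw [Real.cosh_eq]
    have := Real.exp_le_exp.2 hω
    have := Real.exp_pos (-‖∑ i, Z i ω‖)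
    linarith
  have h1 := measureReal_mono (μ := P) hsub
  have h2 : Real.cosh B ^ Fintype.card ι ≤ Real.exp (Fintype.card ι * (B ^ 2 / 2)) := by
    rw [Real.exp_nat_mul]
    exact pow_le_pow_left₀ (Real.cosh_pos _).le (Real.cosh_le_exp_half_sq B) _
  have h3 := (mul_le_mul_of_nonneg_left h1 (by positivity : 0 ≤ Real.exp t / 2)).trans
    (hmk.trans ((key Finset.univ).trans h2))
  rw [Real.exp_sub, ← mul_div_assoc, le_div_iff₀ (Real.exp_pos t)]
  linarith

/-- Dimension-free Hoeffding inequality in Euclidean space: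
`P(‖∑ Zₙ‖ ≥ t) ≤ 2 exp(-t² / (2 N B²))`. -/
theorem measure_norm_sum_ge_le {ι : Type*} [Fintype ι] {B : ℝ} (hB : 0 < B) {Z : ι → Ω → E}
    (hZ : ∀ i, Measurable (Z i)) (hind : iIndepFun Z P) (hZb : ∀ i ω, ‖Z i ω‖ ≤ B)
    (hmean : ∀ i, ∫ ω, Z i ω ∂P = 0) {t : ℝ} (ht : 0 < t) (hι : 0 < Fintype.card ι) :
    P.real {ω | t ≤ ‖∑ i, Z i ω‖} ≤
      2 * Real.exp (-(t ^ 2 / (2 * Fintype.card ι * B ^ 2))) := by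
  have hn : (0 : ℝ) < Fintype.card ι := by exact_mod_cast hι
  -- the optimal scaling of the steps
  set l : ℝ := t / (Fintype.card ι * B ^ 2) with hl
  have hl0 : 0 < l := by positivity
  have h := measure_norm_sum_ge_le_exp_sub (P := P) (B := l * B) (by positivity)
    (Z := fun i ω => l • Z i ω) (fun i => (hZ i).const_smul l)
    (hind.comp (fun _ z => l • z) fun _ => measurable_const_smul l)
    (fun i ω => by
      rw [norm_smul, Real.norm_eq_abs, abs_of_pos hl0]
      exact mul_le_mul_of_nonneg_left (hZb i ω) hl0.le)
    (fun i => by rw [integral_smul, hmean i, smul_zero]) (l * t)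
  have e : {ω | l * t ≤ ‖∑ i, l • Z i ω‖} = {ω | t ≤ ‖∑ i, Z i ω‖} := by
    ext ω
    rw [Set.mem_ofPred_eq, Set.mem_ofPred_eq, ← Finset.smul_sum, norm_smul, Real.norm_eq_abs,
      abs_of_pos hl0, mul_le_mul_iff_right₀ hl0]
  rw [e] at h
  refine h.trans (le_of_eq ?_)
  congr 2
  rw [hl]
  field_simp
  ring

/-- Bernstein inequality in Chernoff form: `P(∑ fₙ ≥ t) ≤ exp(-l t + N l² v)` for `0 ≤ l ≤ 1`,
centred `fₙ` with values in `[-1, 1]`, and variance proxy `v`. -/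
theorem measure_sum_ge_le_bernstein {ι : Type*} [Fintype ι] {f : ι → Ω → ℝ} {v l : ℝ}
    (hf : ∀ i, Measurable (f i)) (hind : iIndepFun f P) (hfb : ∀ i ω, |f i ω| ≤ 1)
    (hmean : ∀ i, ∫ ω, f i ω ∂P = 0) (hvar : ∀ i, ∫ ω, f i ω ^ 2 ∂P ≤ v)
    (hl0 : 0 ≤ l) (hl1 : l ≤ 1) (t : ℝ) :
    P.real {ω | t ≤ ∑ i, f i ω} ≤ Real.exp (-l * t + Fintype.card ι * (l ^ 2 * v)) := by
  have hint : ∀ i, Integrable (f i) P := fun i =>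
    Integrable.of_bound (hf i).aestronglyMeasurable 1 (Filter.Eventually.of_forall (hfb i))
  have hint2 : ∀ i, Integrable (fun ω => f i ω ^ 2) P := fun i =>
    Integrable.of_bound ((hf i).pow_const 2).aestronglyMeasurable 1
      (Filter.Eventually.of_forall fun ω => by
        rw [Real.norm_eq_abs, abs_pow]; exact pow_le_one₀ (abs_nonneg _) (hfb i ω))
  have hmgf : ∀ i, mgf (f i) P l ≤ Real.exp (l ^ 2 * v) := fun i => by
    have hpt : ∀ ω, Real.exp (l * f i ω) ≤ 1 + l * f i ω + l ^ 2 * f i ω ^ 2 := fun ω => by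
      have hb : |l * f i ω| ≤ 1 := by
        rw [abs_mul, abs_of_nonneg hl0]
        exact mul_le_one₀ hl1 (abs_nonneg _) (hfb i ω)
      have := (abs_le.1 (Real.abs_exp_sub_one_sub_id_le hb)).2
      rw [mul_pow] at this
      linarith
    have hI : Integrable (fun ω => 1 + l * f i ω + l ^ 2 * f i ω ^ 2) P :=
      ((integrable_const 1).add ((hint i).const_mul l)).add ((hint2 i).const_mul _)
    calc mgf (f i) P l ≤ ∫ ω, (1 + l * f i ω + l ^ 2 * f i ω ^ 2) ∂P :=
          integral_mono_of_nonneg (Filter.Eventually.of_forall fun _ => (Real.exp_pos _).le) hI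
            (Filter.Eventually.of_forall hpt)
      _ = 1 + l ^ 2 * ∫ ω, f i ω ^ 2 ∂P := by
          have hI1 : Integrable (fun ω => 1 + l * f i ω) P :=
            (integrable_const 1).add ((hint i).const_mul l)
          rw [integral_add hI1 ((hint2 i).const_mul _),
            integral_add (integrable_const 1) ((hint i).const_mul l),
            integral_const_mul, integral_const_mul, hmean i]
          simp
      _ ≤ 1 + l ^ 2 * v := by have := hvar i; gcongr
      _ ≤ Real.exp (l ^ 2 * v) := by rw [add_comm]; exact Real.add_one_le_exp _
  have hexp : Integrable (fun ω => Real.exp (l * (∑ i, f i) ω)) P := by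
    refine Integrable.of_bound ?_ (Real.exp (Fintype.card ι)) (Filter.Eventually.of_forall
      fun ω => ?_)
    · have hm : Measurable (∑ i, f i) := by
        convert Finset.measurable_fun_sum Finset.univ fun i _ => hf i using 1
        ext ω
        simp
      exact (Real.measurable_exp.comp (hm.const_mul l)).aestronglyMeasurable
    · rw [Real.norm_eq_abs, abs_of_pos (Real.exp_pos _), Real.exp_le_exp, Finset.sum_apply]
      have h1 : |∑ i, f i ω| ≤ Fintype.card ι :=
        (Finset.abs_sum_le_sum_abs _ _).trans ((Finset.sum_le_sum fun i _ => hfb i ω).trans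
          (by simp))
      calc l * ∑ i, f i ω ≤ l * |∑ i, f i ω| :=
            mul_le_mul_of_nonneg_left (le_abs_self _) hl0
        _ ≤ 1 * |∑ i, f i ω| := mul_le_mul_of_nonneg_right hl1 (abs_nonneg _)
        _ ≤ _ := by simpa using h1
  have h := measure_ge_le_exp_mul_mgf (μ := P) (X := ∑ i, f i) t hl0 hexp
  rw [hind.mgf_sum hf] at h
  have h2 : ∏ i, mgf (f i) P l ≤ Real.exp (Fintype.card ι * (l ^ 2 * v)) := by
    rw [Real.exp_nat_mul]
    exact (Finset.prod_le_prod (fun i _ => mgf_nonneg) fun i _ => hmgf i).trans (by simp)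
  rw [Real.exp_add]
  refine le_trans (le_of_eq ?_) (h.trans (mul_le_mul_of_nonneg_left h2 (Real.exp_pos _).le))
  simp

end Concentration

/-! ### The law of the data -/

section Pi

variable {X : Type*} [MeasurableSpace X] {ν : Measure X} [IsProbabilityMeasure ν] {N : ℕ}

theorem iIndepFun_comp_eval {E : Type*} [MeasurableSpace E] {F : X → E} (hF : Measurable F) :
    iIndepFun (fun (n : Fin N) (x : Fin N → X) => F (x n)) (Measure.pi fun _ => ν) :=
  iIndepFun_pi (X := fun _ => F) fun _ => hF.aemeasurable

theorem integral_comp_eval {E : Type*} [NormedAddCommGroup E] [NormedSpace ℝ E] {F : X → E}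
    (hF : AEStronglyMeasurable F ν) (n : Fin N) :
    ∫ x, F (x n) ∂(Measure.pi fun _ : Fin N => ν) = ∫ x, F x ∂ν := by
  have h := measurePreserving_eval (fun _ : Fin N => ν) n
  have h2 := integral_map (μ := Measure.pi fun _ : Fin N => ν) h.measurable.aemeasurable
    (f := F) (by rw [h.map_eq]; exact hF)
  rw [h.map_eq] at h2
  exact h2.symm

theorem pi_norm_sum_ge_le {ι : Type*} [Fintype ι] {F : X → EuclideanSpace ℝ ι} (hF : Measurable F)
    (hb : ∀ x, ‖F x‖ ≤ 2) (hmean : ∫ x, F x ∂ν = 0) (hN : 0 < N) {t : ℝ} (ht : 0 < t) :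
    (Measure.pi fun _ : Fin N => ν).real {x | t ≤ ‖∑ n, F (x n)‖} ≤
      2 * Real.exp (-(t ^ 2 / (8 * N))) := by
  have h := measure_norm_sum_ge_le (P := Measure.pi fun _ : Fin N => ν) (B := 2) two_pos
    (Z := fun n x => F (x n)) (fun n => hF.comp (measurable_pi_apply n)) (iIndepFun_comp_eval hF)
    (fun n x => hb _) (fun n => by rw [integral_comp_eval hF.aestronglyMeasurable, hmean]) ht
    (by simpa using hN)
  rw [Fintype.card_fin] at h
  convert h using 5
  ring

theorem pi_sum_ge_le {f : X → ℝ} {v l : ℝ} (hf : Measurable f) (hb : ∀ x, |f x| ≤ 1)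
    (hmean : ∫ x, f x ∂ν = 0) (hvar : ∫ x, f x ^ 2 ∂ν ≤ v) (hl0 : 0 ≤ l) (hl1 : l ≤ 1) (t : ℝ) :
    (Measure.pi fun _ : Fin N => ν).real {x | t ≤ ∑ n, f (x n)} ≤
      Real.exp (-l * t + N * (l ^ 2 * v)) := by
  have h := measure_sum_ge_le_bernstein (P := Measure.pi fun _ : Fin N => ν)
    (f := fun n x => f (x n)) (v := v) (fun n => hf.comp (measurable_pi_apply n))
    (iIndepFun_comp_eval hf) (fun n x => hb _)
    (fun n => by rw [integral_comp_eval hf.aestronglyMeasurable, hmean])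
    (fun n => by
      rw [integral_comp_eval (F := fun x => f x ^ 2) (hf.pow_const 2).aestronglyMeasurable]
      exact hvar) hl0 hl1 t
  rwa [Fintype.card_fin] at h

end Pi

section SampleLaw

set_option linter.unusedSectionVars false

variable {S A : Type*} [MeasurableSpace S] [MeasurableSpace A] [Countable A]
  [MeasurableSingletonClass A] {𝓜 : MDP S A} {d : ℕ} {D : Measure (S × A)} [IsProbabilityMeasure D]

instance : IsProbabilityMeasure (𝓜.sampleLaw D) := by
  unfold MDP.sampleLaw
  infer_instance

theorem integral_sampleLaw {f : Sample S A → ℝ} (hf : Measurable f) {C : ℝ}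
    (hC : ∀ x, |f x| ≤ C) :
    ∫ x, f x ∂𝓜.sampleLaw D =
      ∫ z, ∫ y, f (z, y) ∂((𝓜.P z).prod (bernoulliMeasure true false (𝓜.β z.2))) ∂D := by
  have hint : Integrable f (𝓜.sampleLaw D) :=
    Integrable.of_bound hf.aestronglyMeasurable C (Filter.Eventually.of_forall hC)
  unfold MDP.sampleLaw at hint ⊢
  rw [Measure.integral_compProd hint]
  refine integral_congr_ae (Filter.Eventually.of_forall fun z => ?_)
  simp only [Kernel.prod_apply, Kernel.prodMkLeft_apply]
  rfl

theorem integral_sampleLaw_state {f : S × A → S → ℝ} (hf : Measurable (Function.uncurry f)) {C : ℝ}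
    (hC : ∀ z s, |f z s| ≤ C) :
    ∫ x, f x.1 x.2.1 ∂𝓜.sampleLaw D = ∫ z, ∫ s, f z s ∂𝓜.P z ∂D := by
  rw [integral_sampleLaw (f := fun x => f x.1 x.2.1)
    (hf.comp (measurable_fst.prodMk (measurable_fst.comp measurable_snd))) fun x => hC _ _]
  refine integral_congr_ae (Filter.Eventually.of_forall fun z => ?_)
  dsimp only
  rw [integral_fun_fst (fun s => f z s)]
  simp

theorem integral_sampleLaw_burst {f : S × A → Bool → ℝ} (hf : Measurable (Function.uncurry f))
    {C : ℝ} (hC : ∀ z b, |f z b| ≤ C) :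
    ∫ x, f x.1 x.2.2 ∂𝓜.sampleLaw D =
      ∫ z, (𝓜.β z.2 * f z true + (1 - 𝓜.β z.2) * f z false) ∂D := by
  rw [integral_sampleLaw (f := fun x => f x.1 x.2.2)
    (hf.comp (measurable_fst.prodMk (measurable_snd.comp measurable_snd))) fun x => hC _ _]
  refine integral_congr_ae (Filter.Eventually.of_forall fun z => ?_)
  dsimp only
  rw [integral_fun_snd (fun b => f z b), integral_bernoulliMeasure]
  simp

theorem integral_sampleLaw_fst {f : S × A → ℝ} (hf : Measurable f) {C : ℝ}
    (hC : ∀ z, |f z| ≤ C) : ∫ x, f x.1 ∂𝓜.sampleLaw D = ∫ z, f z ∂D := by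
  rw [integral_sampleLaw_state (f := fun z _ => f z) (hf.comp measurable_fst) fun z _ => hC z]
  simp

/-- The deviation of the rank-one matrix `φ φᵀ` of one data point from its mean, as a vector indexed
by pairs, so that its norm is the Frobenius norm. -/
noncomputable def gramNoise (L : LinearModel 𝓜 d) (D : Measure (S × A)) (x : Sample S A) :
    EuclideanSpace ℝ (Fin d × Fin d) :=
  WithLp.toLp 2 fun q => L.φ x.1 q.1 * L.φ x.1 q.2 - secondMoment L.φ D q.1 q.2

/-- The regression noise `φ(s, a) (φ(s', a') - M(a')ᵀ φ(s, a))ᵀ` of one data point. -/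
noncomputable def crossNoise (L : LinearModel 𝓜 d) (a : A) (x : Sample S A) :
    EuclideanSpace ℝ (Fin d × Fin d) :=
  WithLp.toLp 2 fun q => L.φ x.1 q.1 *
    (L.φ (x.2.1, a) q.2 - ((L.φ x.1).ofLp ᵥ* L.actionMatrix a) q.2)

open Classical in
/-- The deviation of the indicator of playing `a` from its mean, with reversed sign. -/
noncomputable def countNoise (D : Measure (S × A)) (a : A) (x : Sample S A) : ℝ :=
  D.real {z | z.2 = a} - if x.1.2 = a then 1 else 0

open Classical in
/-- The deviation of the burst indicator from its mean on the event that `a` is played. -/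
noncomputable def burstNoise (𝓜 : MDP S A) (a : A) (x : Sample S A) : ℝ :=
  if x.1.2 = a then (if x.2.2 = true then 1 else 0) - (𝓜.β a : ℝ) else 0

theorem l2_mul_le {ι κ : Type*} [Fintype ι] [Fintype κ] (u : ι → ℝ) (v : κ → ℝ) :
    l2 (fun q : ι × κ => u q.1 * v q.2) = l2 u * l2 v := by
  rw [← sq_eq_sq₀ (l2_nonneg _) (mul_nonneg (l2_nonneg _) (l2_nonneg _)), mul_pow, l2_sq, l2_sq,
    l2_sq, Fintype.sum_prod_type, Finset.sum_mul_sum]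
  simp [mul_pow]

theorem l2_sub_le {ι : Type*} [Fintype ι] (u v : ι → ℝ) : l2 (u - v) ≤ l2 u + l2 v := by
  rw [sub_eq_add_neg, ← l2_neg v]
  exact l2_add_le _ _

variable (L : LinearModel 𝓜 d)

theorem integral_eq_zero_of_coord {ι X : Type*} [Fintype ι] [MeasurableSpace X] {ν : Measure X}
    [IsFiniteMeasure ν] {F : X → EuclideanSpace ℝ ι} (hF : Measurable F) {C : ℝ}
    (hb : ∀ x, ‖F x‖ ≤ C) (h : ∀ i, ∫ x, F x i ∂ν = 0) : ∫ x, F x ∂ν = 0 := by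
  ext i
  rw [eval_integral_piLp]
  · simpa using h i
  · intro j
    exact Integrable.of_bound
      ((EuclideanSpace.proj (𝕜 := ℝ) j).continuous.measurable.comp hF).aestronglyMeasurable C
      (Filter.Eventually.of_forall fun x => (PiLp.norm_apply_le (F x) j).trans (hb x))

theorem abs_φ_mul_φ_le (z : S × A) (i j : Fin d) : |L.φ z i * L.φ z j| ≤ 1 := by
  rw [abs_mul]
  exact mul_le_one₀ (L.abs_φ_le z.1 z.2 i) (abs_nonneg _) (L.abs_φ_le z.1 z.2 j)

theorem l2_secondMoment_le :
    l2 (fun q : Fin d × Fin d => secondMoment L.φ D q.1 q.2) ≤ 1 := by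
  refine l2_le_of_forall_dotProduct_le zero_le_one fun w => ?_
  have hint : ∀ q : Fin d × Fin d, Integrable (fun z => L.φ z q.1 * L.φ z q.2 * w q) D :=
    fun q => (Integrable.of_bound ((L.measurable_φ_apply q.1).mul
      (L.measurable_φ_apply q.2)).aestronglyMeasurable 1
      (Filter.Eventually.of_forall fun z => abs_φ_mul_φ_le L z q.1 q.2)).mul_const _
  have e : (fun q : Fin d × Fin d => secondMoment L.φ D q.1 q.2) ⬝ᵥ w =
      ∫ z, (fun q : Fin d × Fin d => L.φ z q.1 * L.φ z q.2) ⬝ᵥ w ∂D := by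
    simp only [dotProduct]
    rw [integral_finsetSum _ fun q _ => hint q]
    refine Finset.sum_congr rfl fun q _ => ?_
    rw [integral_mul_const]
    rfl
  rw [e]
  have : ∫ z, (fun q : Fin d × Fin d => L.φ z q.1 * L.φ z q.2) ⬝ᵥ w ∂D ≤
      ∫ _, 1 * l2 w ∂D := by
    refine integral_mono (integrable_finsetSum _ fun q _ => hint q) (integrable_const _) fun z => ?_
    refine (le_abs_self _).trans ((abs_dotProduct_le _ _).trans
      (mul_le_mul_of_nonneg_right ?_ (l2_nonneg w)))
    rw [l2_mul_le (L.φ z).ofLp (L.φ z).ofLp]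
    exact mul_le_one₀ (L.l2_φ_le z.1 z.2) (l2_nonneg _) (L.l2_φ_le z.1 z.2)
  simpa using this

theorem measurable_gramNoise : Measurable (gramNoise L D) :=
  (WithLp.measurable_toLp 2 _).comp (measurable_pi_lambda _ fun q =>
    (((L.measurable_φ_apply q.1).comp measurable_fst).mul
      ((L.measurable_φ_apply q.2).comp measurable_fst)).sub_const _)

theorem norm_gramNoise_le (x : Sample S A) : ‖gramNoise L D x‖ ≤ 2 := by
  have h1 : l2 (fun q : Fin d × Fin d => L.φ x.1 q.1 * L.φ x.1 q.2) ≤ 1 := by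
    rw [l2_mul_le (L.φ x.1).ofLp (L.φ x.1).ofLp]
    exact mul_le_one₀ (L.l2_φ_le _ _) (l2_nonneg _) (L.l2_φ_le _ _)
  have h3 := add_le_add h1 (l2_secondMoment_le (D := D) L)
  rw [one_add_one_eq_two] at h3
  exact (l2_sub_le (fun q : Fin d × Fin d => L.φ x.1 q.1 * L.φ x.1 q.2)
    (fun q => secondMoment L.φ D q.1 q.2)).trans h3

theorem integral_gramNoise : ∫ x, gramNoise L D x ∂𝓜.sampleLaw D = 0 := by
  refine integral_eq_zero_of_coord (measurable_gramNoise L) (norm_gramNoise_le L) fun q => ?_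
  have hm : Measurable fun z => L.φ z q.1 * L.φ z q.2 :=
    (L.measurable_φ_apply q.1).mul (L.measurable_φ_apply q.2)
  have hI : Integrable (fun x : Sample S A => L.φ x.1 q.1 * L.φ x.1 q.2) (𝓜.sampleLaw D) :=
    Integrable.of_bound (hm.comp measurable_fst).aestronglyMeasurable 1
      (Filter.Eventually.of_forall fun x => abs_φ_mul_φ_le L x.1 q.1 q.2)
  have h := integral_sampleLaw_fst (𝓜 := 𝓜) (D := D) hm fun z => abs_φ_mul_φ_le L z q.1 q.2
  change ∫ x : Sample S A, (L.φ x.1 q.1 * L.φ x.1 q.2 - secondMoment L.φ D q.1 q.2)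
    ∂𝓜.sampleLaw D = 0
  rw [integral_sub hI (integrable_const _), h]
  simp [secondMoment]

theorem measurable_φ_vecMul (M : Matrix (Fin d) (Fin d) ℝ) (j : Fin d) :
    Measurable fun z => ((L.φ z).ofLp ᵥ* M) j :=
  Finset.measurable_fun_sum Finset.univ fun i _ => (L.measurable_φ_apply i).mul_const (M i j)

theorem measurable_crossNoise (a : A) : Measurable (crossNoise L a) :=
  (WithLp.measurable_toLp 2 _).comp (measurable_pi_lambda _ fun q =>
    ((L.measurable_φ_apply q.1).comp measurable_fst).mul
      (((L.measurable_φ_left a q.2).comp (measurable_fst.comp measurable_snd)).sub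
        ((measurable_φ_vecMul L _ q.2).comp measurable_fst)))

theorem l2_φ_vecMul_le (z : S × A) (a : A) :
    l2 ((L.φ z).ofLp ᵥ* L.actionMatrix a) ≤ 1 := by
  have : Nonempty A := ⟨a⟩
  exact ((L.trajBound_φ z.1 z.2).vecMul a).l2_le

theorem norm_crossNoise_le (a : A) (x : Sample S A) : ‖crossNoise L a x‖ ≤ 2 := by
  have h := l2_sub_le (L.φ (x.2.1, a)).ofLp ((L.φ x.1).ofLp ᵥ* L.actionMatrix a)
  have h1 := L.l2_φ_le x.2.1 a
  have h2 := l2_φ_vecMul_le L x.1 a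
  have e := l2_mul_le (L.φ x.1).ofLp ((L.φ (x.2.1, a)).ofLp - (L.φ x.1).ofLp ᵥ* L.actionMatrix a)
  change l2 (fun q : Fin d × Fin d => (L.φ x.1).ofLp q.1 *
    ((L.φ (x.2.1, a)).ofLp - (L.φ x.1).ofLp ᵥ* L.actionMatrix a) q.2) ≤ 2
  rw [e]
  calc _ ≤ 1 * (2 : ℝ) := mul_le_mul (L.l2_φ_le _ _) (by linarith) (l2_nonneg _) zero_le_one
    _ = 2 := one_mul _

theorem integral_crossNoise (a : A) : ∫ x, crossNoise L a x ∂𝓜.sampleLaw D = 0 := by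
  refine integral_eq_zero_of_coord (measurable_crossNoise L a) (norm_crossNoise_le L a) fun q => ?_
  have hb : ∀ (z : S × A) (s : S), |L.φ z q.1 *
      (L.φ (s, a) q.2 - ((L.φ z).ofLp ᵥ* L.actionMatrix a) q.2)| ≤ 2 := fun z s => by
    exact (PiLp.norm_apply_le (crossNoise L a (z, (s, true))) q).trans
      (norm_crossNoise_le L a (z, (s, true)))
  have h := integral_sampleLaw_state (𝓜 := 𝓜) (D := D) (f := fun z s => L.φ z q.1 *
      (L.φ (s, a) q.2 - ((L.φ z).ofLp ᵥ* L.actionMatrix a) q.2))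
    (((L.measurable_φ_apply q.1).comp measurable_fst).mul
      (((L.measurable_φ_left a q.2).comp measurable_snd).sub
        ((measurable_φ_vecMul L _ q.2).comp measurable_fst))) hb
  refine h.trans ?_
  refine integral_eq_zero_of_ae (Filter.Eventually.of_forall fun z => ?_)
  have hI : Integrable (fun s => L.φ (s, a) q.2) (𝓜.P z) :=
    Integrable.of_bound (L.measurable_φ_left a q.2).aestronglyMeasurable 1
      (Filter.Eventually.of_forall fun s => L.abs_φ_le s a q.2)
  have := L.φ_vecMul_actionMatrix_apply z.1 z.2 a q.2
  simp only [Pi.zero_apply]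
  rw [integral_const_mul, integral_sub hI (integrable_const _), integral_const]
  rw [this]
  simp

theorem measurableSet_action (a : A) : MeasurableSet {z : S × A | z.2 = a} :=
  measurable_snd (measurableSet_singleton a)

open Classical in
theorem measurable_actionIndicator (a : A) :
    Measurable fun z : S × A => if z.2 = a then (1 : ℝ) else 0 :=
  Measurable.ite (measurableSet_action a) measurable_const measurable_const

open Classical in
theorem integral_actionIndicator (a : A) :
    ∫ z : S × A, (if z.2 = a then (1 : ℝ) else 0) ∂D = D.real {z | z.2 = a} := by
  rw [← integral_indicator_one (measurableSet_action a)]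
  congr 1

theorem measurable_countNoise (a : A) : Measurable (countNoise D a) :=
  measurable_const.sub ((measurable_actionIndicator a).comp measurable_fst)

theorem abs_countNoise_le (a : A) (x : Sample S A) : |countNoise D a x| ≤ 1 := by
  have h0 : 0 ≤ D.real {z | z.2 = a} := measureReal_nonneg
  have h1 : D.real {z | z.2 = a} ≤ 1 := measureReal_le_one
  unfold countNoise
  rw [abs_le]
  split_ifs <;> constructor <;> linarith

open Classical in
theorem integrable_actionIndicator (a : A) :
    Integrable (fun z : S × A => if z.2 = a then (1 : ℝ) else 0) D :=
  Integrable.of_bound (measurable_actionIndicator a).aestronglyMeasurable 1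
    (Filter.Eventually.of_forall fun z => by split_ifs <;> simp)

open Classical in
theorem integral_countNoise (a : A) : ∫ x, countNoise D a x ∂𝓜.sampleLaw D = 0 := by
  refine (integral_sampleLaw_fst (𝓜 := 𝓜) (D := D)
    (f := fun z => D.real {z | z.2 = a} - if z.2 = a then 1 else 0)
    (measurable_const.sub (measurable_actionIndicator a)) (C := 1) fun z => ?_).trans ?_
  · have h0 : 0 ≤ D.real {z | z.2 = a} := measureReal_nonneg
    have h1 : D.real {z | z.2 = a} ≤ 1 := measureReal_le_one
    rw [abs_le]
    split_ifs <;> constructor <;> linarith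
  · rw [integral_sub (integrable_const _) (integrable_actionIndicator a),
      integral_actionIndicator]
    simp

open Classical in
theorem integral_countNoise_sq_le (a : A) :
    ∫ x, countNoise D a x ^ 2 ∂𝓜.sampleLaw D ≤ D.real {z | z.2 = a} := by
  set p := D.real {z | z.2 = a} with hp
  have h0 : 0 ≤ p := measureReal_nonneg
  have h1 : p ≤ 1 := measureReal_le_one
  have e := integral_sampleLaw_fst (𝓜 := 𝓜) (D := D)
    (f := fun z => (p - if z.2 = a then 1 else 0) ^ 2)
    ((measurable_const.sub (measurable_actionIndicator a)).pow_const 2) (C := 1) fun z => by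
      rw [abs_le]
      split_ifs <;> constructor <;> nlinarith
  refine e.le.trans ?_
  have e2 : ∀ z : S × A, (p - if z.2 = a then (1 : ℝ) else 0) ^ 2 =
      p ^ 2 + (1 - 2 * p) * if z.2 = a then 1 else 0 := fun z => by
    split_ifs <;> ring
  simp only [e2]
  rw [integral_add (integrable_const _) ((integrable_actionIndicator a).const_mul _),
    integral_const_mul, integral_actionIndicator, ← hp]
  simp only [integral_const, probReal_univ, smul_eq_mul]
  nlinarith

open Classical in
theorem measurable_burst (a : A) (c : ℝ) : Measurable (Function.uncurry fun (z : S × A) (b : Bool) =>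
    if z.2 = a then (if b = true then (1 : ℝ) else 0) - c else 0) := by
  refine Measurable.ite (measurable_fst (measurableSet_action a)) ?_ measurable_const
  exact (Measurable.ite (measurable_snd (measurableSet_singleton true)) measurable_const
    measurable_const).sub_const _

theorem measurable_burstNoise (a : A) : Measurable (burstNoise 𝓜 a) :=
  (measurable_burst a (𝓜.β a)).comp
    (measurable_fst.prodMk (measurable_snd.comp measurable_snd))

theorem abs_burstNoise_le (a : A) (x : Sample S A) : |burstNoise 𝓜 a x| ≤ 1 := by
  have h0 := (𝓜.β a).2.1
  have h1 := (𝓜.β a).2.2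
  unfold burstNoise
  rw [abs_le]
  split_ifs <;> constructor <;> linarith

open Classical in
theorem integral_burstNoise (a : A) : ∫ x, burstNoise 𝓜 a x ∂𝓜.sampleLaw D = 0 := by
  refine (integral_sampleLaw_burst (𝓜 := 𝓜) (D := D) (f := fun z b =>
    if z.2 = a then (if b = true then (1 : ℝ) else 0) - 𝓜.β a else 0)
    (measurable_burst a (𝓜.β a)) (C := 1)
    fun z b => abs_burstNoise_le (𝓜 := 𝓜) a (z, (z.1, b))).trans ?_
  refine integral_eq_zero_of_ae (Filter.Eventually.of_forall fun z => ?_)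
  by_cases h : z.2 = a
  · simp [h]; ring
  · simp [h]

open Classical in
theorem integral_burstNoise_sq_le (a : A) :
    ∫ x, burstNoise 𝓜 a x ^ 2 ∂𝓜.sampleLaw D ≤ D.real {z | z.2 = a} := by
  have e := integral_sampleLaw_fst (𝓜 := 𝓜) (D := D)
    (measurable_actionIndicator a) (C := 1) fun z => by split_ifs <;> simp
  rw [integral_actionIndicator] at e
  rw [← e]
  refine integral_mono_of_nonneg (Filter.Eventually.of_forall fun x => sq_nonneg _)
    (Integrable.of_bound ((measurable_actionIndicator a).comp
      measurable_fst).aestronglyMeasurable 1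
      (Filter.Eventually.of_forall fun x => by split_ifs <;> simp))
    (Filter.Eventually.of_forall fun x => ?_)
  by_cases h : x.1.2 = a
  · have := abs_burstNoise_le (𝓜 := 𝓜) a x
    simpa [h, sq_le_one_iff_abs_le_one] using this
  · simp [burstNoise, h]

end SampleLaw

/-! ### Error bounds for the estimators on good data -/

section LambdaMin

variable {d : ℕ} {B : Matrix (Fin d) (Fin d) ℝ}

theorem lambdaMin_le {x : ℝ} (hx : x ∈ spectrum ℝ B) : lambdaMin B ≤ x :=
  csInf_le Matrix.finite_real_spectrum.bddBelow hx

/-- The Rayleigh quotient is at least the smallest eigenvalue. -/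
theorem lambdaMin_mul_le (hB : B.IsHermitian) (x : Fin d → ℝ) :
    lambdaMin B * l2 x ^ 2 ≤ x ⬝ᵥ B *ᵥ x := by
  have hH : (B - lambdaMin B • (1 : Matrix (Fin d) (Fin d) ℝ)).IsHermitian :=
    hB.sub (by simp [Matrix.IsHermitian])
  have hps : (B - lambdaMin B • (1 : Matrix (Fin d) (Fin d) ℝ)).PosSemidef := by
    rw [hH.posSemidef_iff_eigenvalues_nonneg]
    intro i
    have h := hH.eigenvalues_mem_spectrum_real i
    generalize hH.eigenvalues i = t at h ⊢
    rw [← Algebra.algebraMap_eq_smul_one, sub_eq_add_neg, ← map_neg, add_comm,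
      show t = lambdaMin B + t + -lambdaMin B by ring, spectrum.add_mem_add_iff] at h
    have := lambdaMin_le h
    simp only [Pi.zero_apply]
    linarith
  have h := hps.dotProduct_mulVec_nonneg x
  simp only [star_trivial, Matrix.sub_mulVec, dotProduct_sub, Matrix.smul_mulVec,
    Matrix.one_mulVec, dotProduct_smul, smul_eq_mul, dotProduct_self_eq_l2_sq] at h
  linarith

theorem lambdaMin_pos (hd : 0 < d) (hB : B.PosDef) : 0 < lambdaMin B := by
  have : Nonempty (Fin d) := ⟨⟨0, hd⟩⟩
  have hne : (spectrum ℝ B).Nonempty :=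
    ⟨_, hB.isHermitian.eigenvalues_mem_spectrum_real (Classical.arbitrary _)⟩
  have hmem : lambdaMin B ∈ spectrum ℝ B :=
    hne.csInf_mem Matrix.finite_real_spectrum
  rw [hB.isHermitian.spectrum_real_eq_range_eigenvalues] at hmem
  obtain ⟨i, hi⟩ := hmem
  rw [← hi]
  exact hB.eigenvalues_pos i

end LambdaMin

section Good

set_option linter.unusedSectionVars false

variable {S A : Type*} [MeasurableSpace S] [MeasurableSpace A] [Countable A]
  [MeasurableSingletonClass A] {𝓜 : MDP S A} {d N : ℕ} {D : Measure (S × A)}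
  [IsProbabilityMeasure D] (L : LinearModel 𝓜 d)

theorem lambdaMin_secondMoment_le_one (hd : 0 < d) (hpd : (secondMoment L.φ D).PosDef) :
    lambdaMin (secondMoment L.φ D) ≤ 1 := by
  have h := lambdaMin_mul_le hpd.isHermitian (Pi.single ⟨0, hd⟩ 1)
  rw [l2_single_one] at h
  have h2 := (le_abs_self _).trans ((abs_apply_le_l2
    (fun q : Fin d × Fin d => secondMoment L.φ D q.1 q.2) (⟨0, hd⟩, ⟨0, hd⟩)).trans
    (l2_secondMoment_le L))
  simp at h
  linarith

/-- The data matrix `X` with rows `φ(sₙ, aₙ)`. -/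
def dataMatrix (φ : S × A → EuclideanSpace ℝ (Fin d)) (x : Fin N → Sample S A) :
    Matrix (Fin N) (Fin d) ℝ := Matrix.of fun n j => φ (x n).1 j

theorem dataMatrix_gram_apply (x : Fin N → Sample S A) (i j : Fin d) :
    ((dataMatrix L.φ x)ᵀ * dataMatrix L.φ x) i j =
      N * secondMoment L.φ D i j + (∑ n, gramNoise L D (x n)) (i, j) := by
  simp [dataMatrix, gramNoise, Matrix.mul_apply]

/-- On good data the regularized Gram matrix is bounded below by half its expectation. -/
theorem le_dotProduct_gram (hpd : (secondMoment L.φ D).PosDef) {x : Fin N → Sample S A}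
    (hgram : ‖∑ n, gramNoise L D (x n)‖ ≤ N * lambdaMin (secondMoment L.φ D) / 2)
    (v : Fin d → ℝ) :
    N * lambdaMin (secondMoment L.φ D) / 2 * l2 v ^ 2 ≤
      v ⬝ᵥ ((dataMatrix L.φ x)ᵀ * dataMatrix L.φ x + 1) *ᵥ v := by
  set W : Matrix (Fin d) (Fin d) ℝ := Matrix.of fun i j => (∑ n, gramNoise L D (x n)) (i, j)
  have e : (dataMatrix L.φ x)ᵀ * dataMatrix L.φ x + 1 =
      (N : ℝ) • secondMoment L.φ D + W + 1 := by
    congr 1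
    ext i j
    rw [dataMatrix_gram_apply (D := D)]
    rfl
  have h1 := mul_le_mul_of_nonneg_left (lambdaMin_mul_le hpd.isHermitian v)
    (Nat.cast_nonneg (α := ℝ) N)
  have h2 : |v ⬝ᵥ W *ᵥ v| ≤ l2 v * ‖∑ n, gramNoise L D (x n)‖ * l2 v := by
    rw [Matrix.dotProduct_mulVec]
    exact (abs_dotProduct_le _ _).trans
      (mul_le_mul_of_nonneg_right (l2_vecMul_le v W) (l2_nonneg v))
  have h3 : l2 v * ‖∑ n, gramNoise L D (x n)‖ * l2 v ≤
      N * lambdaMin (secondMoment L.φ D) / 2 * l2 v ^ 2 := by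
    nlinarith [sq_nonneg (l2 v)]
  have h4 := (abs_le.1 (h2.trans h3)).1
  rw [e, Matrix.add_mulVec, Matrix.add_mulVec, dotProduct_add, dotProduct_add, Matrix.one_mulVec,
    Matrix.smul_mulVec, dotProduct_smul, smul_eq_mul, dotProduct_self_eq_l2_sq]
  nlinarith [sq_nonneg (l2 v)]

/-- Accuracy of the ridge estimator on good data: the noise term `Xᵀ(Y - X M)` and the
regularization bias `M` are both divided by the smallest eigenvalue of the Gram matrix. -/
theorem l2_vecMul_ridge_sub_le (hd : 0 < d) (hN : 0 < N) (hpd : (secondMoment L.φ D).PosDef)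
    {x : Fin N → Sample S A} {a : A} {e : ℝ}
    (hgram : ‖∑ n, gramNoise L D (x n)‖ ≤ N * lambdaMin (secondMoment L.φ D) / 2)
    (hcross : ‖∑ n, crossNoise L a (x n)‖ ≤ N * lambdaMin (secondMoment L.φ D) * e / 4)
    (hbias : 4 * √d ≤ N * lambdaMin (secondMoment L.φ D) * e) (u : Fin d → ℝ) :
    l2 (u ᵥ* (ridge L.φ 1 x a - L.actionMatrix a)) ≤ e * l2 u := by
  have : Nonempty A := ⟨a⟩
  set lam := lambdaMin (secondMoment L.φ D) with hlam
  have hlam0 : 0 < lam := lambdaMin_pos hd hpd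
  have hN0 : (0 : ℝ) < N := by exact_mod_cast hN
  set X := dataMatrix L.φ x with hX
  set Y : Matrix (Fin N) (Fin d) ℝ := Matrix.of fun n j => L.φ ((x n).2.1, a) j with hY
  set M := L.actionMatrix a with hM
  set G := Xᵀ * X + (1 : Matrix (Fin d) (Fin d) ℝ) with hG
  have hGpd : G.PosDef := by
    have h := Matrix.posSemidef_conjTranspose_mul_self X
    rw [Matrix.conjTranspose_eq_transpose_of_trivial] at h
    exact Matrix.PosDef.posSemidef_add h Matrix.PosDef.one
  have hdet : IsUnit G.det := (Matrix.isUnit_iff_isUnit_det G).1 hGpd.isUnit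
  have hridge : ridge L.φ 1 x a = G⁻¹ * Xᵀ * Y := by
    simp [ridge, hG, hX, hY, dataMatrix]
  set W := Xᵀ * (Y - X * M) with hW
  have herr : ridge L.φ 1 x a - M = G⁻¹ * (W - M) := by
    have h1 : G⁻¹ * (G * M) = M := Matrix.nonsing_inv_mul_cancel_left G M hdet
    have h2 : W - M = Xᵀ * Y - G * M := by
      rw [hW, hG, Matrix.mul_sub, Matrix.add_mul, Matrix.one_mul, Matrix.mul_assoc]
      abel
    rw [h2, Matrix.mul_sub, h1, hridge, Matrix.mul_assoc]
  have hWapply : (fun q : Fin d × Fin d => W q.1 q.2) =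
      (∑ n, crossNoise L a (x n)).ofLp := by
    ext q
    simp [hW, hX, hY, dataMatrix, crossNoise, Matrix.mul_apply, Matrix.vecMul, dotProduct, hM]
  set v := u ᵥ* G⁻¹ with hv
  have hvG : v ᵥ* G = u := by
    rw [hv, Matrix.vecMul_vecMul, Matrix.nonsing_inv_mul G hdet, Matrix.vecMul_one]
  have hvle : N * lam / 2 * l2 v ≤ l2 u := by
    have h1 := le_dotProduct_gram L hpd hgram v
    rw [← hX, ← hG, Matrix.dotProduct_mulVec, hvG] at h1
    have h2 := h1.trans ((le_abs_self _).trans (abs_dotProduct_le u v))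
    rcases (l2_nonneg v).eq_or_lt with h0 | h0
    · rw [← h0, mul_zero]; exact l2_nonneg u
    · rw [sq, ← mul_assoc] at h2
      exact le_of_mul_le_mul_right h2 h0
  have hvW : l2 (v ᵥ* W) ≤ l2 v * (N * lam * e / 4) := by
    refine (l2_vecMul_le v W).trans (mul_le_mul_of_nonneg_left ?_ (l2_nonneg v))
    rw [hWapply]
    exact hcross
  have hvM : l2 (v ᵥ* M) ≤ √d * l2 v := ((L.trajBound_of_l2 v).vecMul a).l2_le
  have he : 0 ≤ e := by
    have h0 : 0 ≤ N * lam * e := le_trans (by positivity) hbias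
    exact nonneg_of_mul_nonneg_right h0 (by positivity)
  rw [herr, ← Matrix.vecMul_vecMul, Matrix.vecMul_sub]
  refine (l2_sub_le _ _).trans ((add_le_add hvW hvM).trans ?_)
  have h5 := mul_le_mul_of_nonneg_right hbias (l2_nonneg v)
  have h6 := mul_le_mul_of_nonneg_left hvle he
  nlinarith

open Classical in
theorem empiricalBurst_mem (x : Fin N → Sample S A) (a : A) :
    empiricalBurst x a ∈ Set.Icc (0 : ℝ) 1 := by
  unfold empiricalBurst
  refine ⟨div_nonneg (Finset.sum_nonneg fun n _ => by split_ifs <;> simp)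
    (Finset.sum_nonneg fun n _ => by split_ifs <;> simp), div_le_one_of_le₀
    (Finset.sum_le_sum fun n _ => ?_) (Finset.sum_nonneg fun n _ => by split_ifs <;> simp)⟩
  by_cases h : (x n).1.2 = a <;> by_cases h' : (x n).2.2 = true <;> simp [h, h']

open Classical in
/-- Accuracy of the burst frequencies on good data. -/
theorem abs_empiricalBurst_sub_le {x : Fin N → Sample S A} {a : A} {η : ℝ} (hη : 0 ≤ η)
    (hcount : ∑ n, countNoise D a (x n) < N * D.real {z | z.2 = a} / 2)
    (hburst : |∑ n, burstNoise 𝓜 a (x n)| ≤ η * (N * D.real {z | z.2 = a} / 2)) :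
    |empiricalBurst x a - 𝓜.β a| ≤ η := by
  set c : ℝ := ∑ n, if (x n).1.2 = a then (1 : ℝ) else 0 with hc
  have h1 : ∑ n, countNoise D a (x n) = N * D.real {z | z.2 = a} - c := by
    simp only [countNoise, Finset.sum_sub_distrib, hc]
    simp
  have hcge : N * D.real {z | z.2 = a} / 2 < c := by linarith
  have hc0 : 0 < c := lt_of_le_of_lt (by positivity) hcge
  have h2 : ∑ n, burstNoise 𝓜 a (x n) =
      (∑ n, if (x n).1.2 = a ∧ (x n).2.2 = true then (1 : ℝ) else 0) - 𝓜.β a * c := by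
    rw [hc, Finset.mul_sum, ← Finset.sum_sub_distrib]
    refine Finset.sum_congr rfl fun n _ => ?_
    by_cases h : (x n).1.2 = a <;> simp [burstNoise, h]
  have h3 : empiricalBurst x a - 𝓜.β a = (∑ n, burstNoise 𝓜 a (x n)) / c := by
    rw [h2, sub_div, mul_div_cancel_right₀ _ hc0.ne']
    rfl
  rw [h3, abs_div, abs_of_pos hc0, div_le_iff₀ hc0]
  exact hburst.trans (mul_le_mul_of_nonneg_left hcge.le hη)

end Good

/-! ### Good data are likely -/

section Transfer

variable {X : Type*} [MeasurableSpace X] {ν : Measure X} [IsProbabilityMeasure ν] {N : ℕ}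
  {Ω : Type*} [MeasurableSpace Ω] {Pr : Measure Ω} [IsProbabilityMeasure Pr]

/-- A statement about i.i.d. data may be proved outside a small exceptional set of the product
space. The data are only almost everywhere measurable, so the preimage of the complement is replaced
by a measurable subset of full measure. -/
theorem holdsWithProb_of_pi {z : Fin N → Ω → X} (hind : iIndepFun z Pr)
    (hlaw : ∀ n, HasLaw (z n) ν Pr) {p : ℝ} {bad : Set (Fin N → X)} (hbad : MeasurableSet bad)
    (hp : (Measure.pi fun _ : Fin N => ν).real bad ≤ p) {good : (Fin N → X) → Prop}
    (hgood : ∀ x, x ∉ bad → good x) :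
    HoldsWithProb Pr (1 - p) fun ω => good fun n => z n ω := by
  have hz : ∀ n, AEMeasurable (z n) Pr := fun n => (hlaw n).aemeasurable
  have hmap := (iIndepFun_iff_map_fun_eq_pi_map hz).1 hind
  simp only [fun n => (hlaw n).map_eq] at hmap
  have hzm : AEMeasurable (fun ω n => z n ω) Pr := aemeasurable_pi_lambda _ hz
  obtain ⟨E, hEs, hEm, hE⟩ :=
    (hzm.nullMeasurableSet_preimage hbad.compl).exists_measurable_subset_ae_eq
  refine ⟨E, hEm, fun ω hω => hgood _ (hEs hω), ?_⟩
  have h1 : Pr.real E = (Measure.pi fun _ : Fin N => ν).real badᶜ := by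
    rw [measureReal_congr hE, ← hmap, map_measureReal_apply_of_aemeasurable hzm hbad.compl]
  rw [h1, probReal_compl_eq_one_sub hbad]
  linarith

end Transfer

theorem one_half_le_log {A d p : ℝ} (hA : 1 ≤ A) (hd : 1 ≤ d) (hp0 : 0 < p) (hp1 : p < 1) :
    1 / 2 ≤ Real.log (2 * A * d / p) := by
  have h : (2 : ℝ) ≤ 2 * A * d / p := by
    rw [le_div_iff₀ hp0]
    nlinarith [mul_le_mul hA hd zero_le_one (by linarith)]
  have := Real.log_le_log two_pos h
  linarith [Real.log_two_gt_d9]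

/-- Exponents of order `log (2 A d / p)` are large enough for a union bound over the actions. -/
theorem two_mul_exp_neg_le {A d p s : ℝ} (hA : 1 ≤ A) (hd : 1 ≤ d) (hp0 : 0 < p) (hp1 : p < 1)
    (hs : 4 * Real.log (2 * A * d / p) ≤ s) : 2 * Real.exp (-s) ≤ p / (8 * A) := by
  have hpos : 0 < 2 * A * d / p := by positivity
  have h1 : Real.exp (-s) ≤ ((2 * A * d / p)⁻¹) ^ 4 := by
    rw [← Real.exp_log (inv_pos.2 hpos), ← Real.exp_nat_mul, Real.exp_le_exp, Real.log_inv]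
    push_cast
    linarith
  set y := p / (2 * A) with hy
  have hy0 : 0 < y := by positivity
  have hy1 : y ≤ 1 / 2 := by
    rw [hy, div_le_iff₀ (by positivity)]
    linarith
  have h2 : (2 * A * d / p)⁻¹ ≤ y := by
    rw [inv_div]
    exact div_le_div_of_nonneg_left hp0.le (by positivity) (by nlinarith)
  have h3 : ((2 * A * d / p)⁻¹) ^ 4 ≤ y ^ 4 := pow_le_pow_left₀ (by positivity) h2 4
  have h4 : y ^ 4 ≤ y * (1 / 2) ^ 3 := by
    rw [pow_succ' y 3]
    exact mul_le_mul_of_nonneg_left (pow_le_pow_left₀ hy0.le hy1 3) hy0.le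
  have h5 : p / (8 * A) = y / 4 := by rw [hy]; field_simp; ring
  rw [h5]
  linarith

section Events

set_option linter.unusedSectionVars false

variable {S A : Type*} [MeasurableSpace S] [MeasurableSpace A] [Fintype A]
  [MeasurableSingletonClass A] {𝓜 : MDP S A} {d N : ℕ} {D : Measure (S × A)}
  [IsProbabilityMeasure D] (L : LinearModel 𝓜 d) {p e η : ℝ}

/-- The exceptional data for the ridge estimators. -/
def badRegression (D : Measure (S × A)) (N : ℕ) (e : ℝ) : Set (Fin N → Sample S A) :=
  {x | N * lambdaMin (secondMoment L.φ D) / 2 ≤ ‖∑ n, gramNoise L D (x n)‖} ∪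
    ⋃ a, {x | N * lambdaMin (secondMoment L.φ D) * e / 4 ≤ ‖∑ n, crossNoise L a (x n)‖}

/-- The exceptional data for the burst frequencies. -/
def badBurst (𝓜 : MDP S A) (D : Measure (S × A)) (N : ℕ) (η : ℝ) : Set (Fin N → Sample S A) :=
  ⋃ a, ({x | N * D.real {z | z.2 = a} / 2 ≤ ∑ n, countNoise D a (x n)} ∪
    ({x | η * (N * D.real {z | z.2 = a} / 2) ≤ ∑ n, burstNoise 𝓜 a (x n)} ∪
      {x | η * (N * D.real {z | z.2 = a} / 2) ≤ ∑ n, -burstNoise 𝓜 a (x n)}))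

theorem measurableSet_badRegression : MeasurableSet (badRegression L D N e) := by
  refine (measurableSet_le measurable_const ?_).union
    (MeasurableSet.iUnion fun a => measurableSet_le measurable_const ?_)
  · exact (Finset.measurable_fun_sum _ fun n _ =>
      (measurable_gramNoise L).comp (measurable_pi_apply n)).norm
  · exact (Finset.measurable_fun_sum _ fun n _ =>
      (measurable_crossNoise L a).comp (measurable_pi_apply n)).norm

theorem measurableSet_badBurst : MeasurableSet (badBurst 𝓜 D N η) := by
  refine MeasurableSet.iUnion fun a => (measurableSet_le measurable_const ?_).union
    ((measurableSet_le measurable_const ?_).union (measurableSet_le measurable_const ?_))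
  · exact Finset.measurable_fun_sum _ fun n _ =>
      (measurable_countNoise a).comp (measurable_pi_apply n)
  · exact Finset.measurable_fun_sum _ fun n _ =>
      (measurable_burstNoise a).comp (measurable_pi_apply n)
  · exact Finset.measurable_fun_sum _ fun n _ =>
      ((measurable_burstNoise a).comp (measurable_pi_apply n)).neg

theorem sum_const_div_card [Nonempty A] (p : ℝ) :
    ∑ _ : A, p / (8 * (Fintype.card A : ℝ)) = p / 8 := by
  have : (Fintype.card A : ℝ) ≠ 0 := by exact_mod_cast Fintype.card_ne_zero
  rw [Finset.sum_const, Finset.card_univ, nsmul_eq_mul]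
  field_simp

theorem measure_badRegression_le [Nonempty A] (hd : 0 < d) (hN : 0 < N)
    (hpd : (secondMoment L.φ D).PosDef) (hp0 : 0 < p) (hp1 : p < 1) (he0 : 0 < e) (he1 : e ≤ 1)
    (h : 512 * Real.log (2 * Fintype.card A * d / p) ≤
      N * lambdaMin (secondMoment L.φ D) ^ 2 * e ^ 2) :
    (Measure.pi fun _ : Fin N => 𝓜.sampleLaw D).real (badRegression L D N e) ≤ p / 4 := by
  set lam := lambdaMin (secondMoment L.φ D) with hlam
  have hlam0 : 0 < lam := lambdaMin_pos hd hpd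
  have hN0 : (0 : ℝ) < N := by exact_mod_cast hN
  have hA1 : (1 : ℝ) ≤ Fintype.card A := by exact_mod_cast Fintype.card_pos (α := A)
  have hd1 : (1 : ℝ) ≤ d := by exact_mod_cast hd
  set lg := Real.log (2 * Fintype.card A * d / p) with hlg
  have hgram : (Measure.pi fun _ : Fin N => 𝓜.sampleLaw D).real
      {x | N * lam / 2 ≤ ‖∑ n, gramNoise L D (x n)‖} ≤ p / (8 * Fintype.card A) := by
    refine (pi_norm_sum_ge_le (measurable_gramNoise L) (norm_gramNoise_le L)
      (integral_gramNoise L) hN (by positivity)).trans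
      (two_mul_exp_neg_le hA1 hd1 hp0 hp1 ?_)
    have e1 : (N * lam / 2) ^ 2 / (8 * N) = N * lam ^ 2 / 32 := by field_simp; ring
    have e2 : (N : ℝ) * lam ^ 2 * e ^ 2 ≤ N * lam ^ 2 :=
      mul_le_of_le_one_right (by positivity) (pow_le_one₀ he0.le he1)
    have := one_half_le_log hA1 hd1 hp0 hp1
    rw [e1, ← hlg]
    linarith
  have hcross : ∀ a, (Measure.pi fun _ : Fin N => 𝓜.sampleLaw D).real
      {x | N * lam * e / 4 ≤ ‖∑ n, crossNoise L a (x n)‖} ≤ p / (8 * Fintype.card A) := fun a => by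
    refine (pi_norm_sum_ge_le (measurable_crossNoise L a) (norm_crossNoise_le L a)
      (integral_crossNoise L a) hN (by positivity)).trans
      (two_mul_exp_neg_le hA1 hd1 hp0 hp1 ?_)
    have e1 : (N * lam * e / 4) ^ 2 / (8 * N) = N * lam ^ 2 * e ^ 2 / 128 := by field_simp; ring
    rw [e1, ← hlg]
    linarith
  have hunion := (measureReal_iUnion_fintype_le (μ := Measure.pi fun _ : Fin N => 𝓜.sampleLaw D)
    fun a => {x : Fin N → Sample S A | N * lam * e / 4 ≤ ‖∑ n, crossNoise L a (x n)‖}).trans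
    (Finset.sum_le_sum fun a _ => hcross a)
  rw [sum_const_div_card] at hunion
  have h8 : p / (8 * Fintype.card A) ≤ p / 8 :=
    div_le_div_of_nonneg_left hp0.le (by norm_num) (by linarith)
  refine (measureReal_union_le _ _).trans ((add_le_add hgram hunion).trans ?_)
  linarith

theorem measure_badBurst_le [Nonempty A] (hd : 0 < d) (hp0 : 0 < p) (hp1 : p < 1)
    (hη0 : 0 < η) (hη1 : η ≤ 1)
    (h : ∀ a, 64 * Real.log (2 * Fintype.card A * d / p) ≤
      N * D.real {z | z.2 = a} * η ^ 2) :
    (Measure.pi fun _ : Fin N => 𝓜.sampleLaw D).real (badBurst 𝓜 D N η) ≤ p / 2 := by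
  have hA1 : (1 : ℝ) ≤ Fintype.card A := by exact_mod_cast Fintype.card_pos (α := A)
  have hd1 : (1 : ℝ) ≤ d := by exact_mod_cast hd
  set lg := Real.log (2 * Fintype.card A * d / p) with hlg
  have hlg0 := one_half_le_log hA1 hd1 hp0 hp1
  have hexp : ∀ s t : ℝ, 4 * lg ≤ s → t = -s → Real.exp t ≤ p / (8 * Fintype.card A) :=
    fun s t hs ht => by
      have := two_mul_exp_neg_le hA1 hd1 hp0 hp1 hs
      rw [ht]
      linarith [Real.exp_pos (-s)]
  have hη2 : η ^ 2 ≤ 1 := pow_le_one₀ hη0.le hη1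
  have hsingle : ∀ a, (Measure.pi fun _ : Fin N => 𝓜.sampleLaw D).real
      ({x | N * D.real {z | z.2 = a} / 2 ≤ ∑ n, countNoise D a (x n)} ∪
    ({x | η * (N * D.real {z | z.2 = a} / 2) ≤ ∑ n, burstNoise 𝓜 a (x n)} ∪
      {x | η * (N * D.real {z | z.2 = a} / 2) ≤ ∑ n, -burstNoise 𝓜 a (x n)})) ≤
      p / (8 * Fintype.card A) + (p / (8 * Fintype.card A) + p / (8 * Fintype.card A)) := by
    intro a
    have ha := h a
    set q := D.real {z | z.2 = a} with hq
    have hNq : 0 ≤ N * q := mul_nonneg (Nat.cast_nonneg _) measureReal_nonneg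
    have hle : N * q * η ^ 2 ≤ N * q := mul_le_of_le_one_right hNq hη2
    -- the parameter `l` is half the ratio of the threshold to the total variance proxy
    refine (measureReal_union_le _ _).trans (add_le_add ?_ ((measureReal_union_le _ _).trans
      (add_le_add ?_ ?_)))
    · exact (pi_sum_ge_le (measurable_countNoise a) (abs_countNoise_le a) (integral_countNoise a)
        (integral_countNoise_sq_le a) (l := 1 / 4) (by norm_num) (by norm_num) _).trans
        (hexp (N * q / 16) _ (by linarith) (by rw [← hq]; ring))
    · exact (pi_sum_ge_le (measurable_burstNoise a) (abs_burstNoise_le a) (integral_burstNoise a)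
        (integral_burstNoise_sq_le a) (l := η / 4) (by positivity) (by linarith) _).trans
        (hexp (N * q * η ^ 2 / 16) _ (by linarith) (by rw [← hq]; ring))
    · exact (pi_sum_ge_le (measurable_burstNoise a).neg
        (fun x => by rw [Pi.neg_apply, abs_neg]; exact abs_burstNoise_le a x)
        (by simp only [Pi.neg_apply]; rw [integral_neg, integral_burstNoise, neg_zero])
        (by simpa only [Pi.neg_apply, neg_sq] using integral_burstNoise_sq_le a)
        (l := η / 4) (by positivity) (by linarith) _).trans
        (hexp (N * q * η ^ 2 / 16) _ (by linarith) (by rw [← hq]; ring))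
  refine (measureReal_iUnion_fintype_le _).trans
    ((Finset.sum_le_sum fun a _ => hsingle a).trans ?_)
  rw [Finset.sum_add_distrib, Finset.sum_add_distrib, sum_const_div_card]
  linarith

end Events

section Final

variable {S A : Type*} [MeasurableSpace S] [MeasurableSpace A] [Fintype A]
  [MeasurableSingletonClass A] [TopologicalSpace A] [DiscreteTopology A]
  {𝓜 : MDP S A} {d N : ℕ} {D : Measure (S × A)}
  [IsProbabilityMeasure D] (L : LinearModel 𝓜 d) {p ε : ℝ}

/-- Outside the exceptional data the estimated feature map is admissible, for any burst
probabilities within `ε (1 - γ) / 64` of the true ones. -/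
theorem isAdmissible_of_notMem_badRegression (hd : 0 < d) (hN : 0 < N)
    (hpd : (secondMoment L.φ D).PosDef) (hε0 : 0 < ε) (hε1 : ε < 1)
    (hbias : 256 * (d : ℝ) ≤ N * lambdaMin (secondMoment L.φ D) * (ε * (1 - 𝓜.γ)))
    {x : Fin N → Sample S A} (hx : x ∉ badRegression L D N (ε * (1 - 𝓜.γ) / (64 * √d)))
    {β' : A → ℝ} (hβ' : ∀ a, β' a ∈ Set.Icc (0 : ℝ) 1)
    (hβη : ∀ a, |β' a - 𝓜.β a| ≤ ε * (1 - 𝓜.γ) / 64) {εM εβ : ℝ}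
    (hεβ : 32 * d * (εM + εβ / √d) / (1 - 𝓜.γ) = ε) :
    IsAdmissible ε L.ψ (normalizedFeatureMap L.φ 𝓜.γ β' (ridge L.φ 1 x) εM εβ) := by
  have hγ0 := 𝓜.γ_mem.1
  have hγ1 := 𝓜.γ_mem.2
  have h1γ : 0 < 1 - 𝓜.γ := by linarith
  have hsd : 0 < √(d : ℝ) := Real.sqrt_pos.2 (by exact_mod_cast hd)
  have hssd : √(d : ℝ) * √d = d := Real.mul_self_sqrt (Nat.cast_nonneg d)
  set e := ε * (1 - 𝓜.γ) / (64 * √d) with he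
  have he0 : 0 < e := by positivity
  have hse : √d * e = ε * (1 - 𝓜.γ) / 64 := by rw [he]; field_simp
  have hnorm : 1 + 16 * d * (εM + εβ / √d) / (1 - 𝓜.γ) = 1 + ε / 2 := by
    rw [← hεβ]; ring
  have hfun : normalizedFeatureMap L.φ 𝓜.γ β' (ridge L.φ 1 x) εM εβ =
      fun s a => (1 + ε / 2)⁻¹ • featureMap L.φ 𝓜.γ β' (ridge L.φ 1 x) s a := by
    funext s a
    rw [normalizedFeatureMap, hnorm]
  rw [hfun]
  rcases isEmpty_or_nonempty A with hA | hA
  · exact ⟨fun s a => (hA.false (a 0)).elim, fun s a => (hA.false (a 0)).elim,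
      fun s => continuous_iff_continuousAt.2 fun a => (hA.false (a 0)).elim⟩
  simp only [badRegression, Set.mem_union, Set.mem_iUnion, Set.mem_ofPred_eq, not_or, not_le,
    not_exists] at hx
  have hridge : ∀ u a, l2 (u ᵥ* (ridge L.φ 1 x a - L.actionMatrix a)) ≤ e * l2 u := fun u a => by
    refine l2_vecMul_ridge_sub_le L hd hN hpd hx.1.le (hx.2 a).le ?_ u
    rw [he, ← mul_div_assoc, le_div_iff₀ (by positivity)]
    calc 4 * √(d : ℝ) * (64 * √d) = 256 * (√d * √d) := by ring
      _ ≤ _ := by rw [hssd]; exact hbias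
  refine isAdmissible_of_close hγ0 hγ1 L.trajBound_φ (Real.sqrt_nonneg _) L.trajBound_of_l2
    (fun a => (𝓜.β a).2) hβ' hε0 hε1 hβη fun u r a hu => ?_
  rw [← hse]
  exact trajBound_vecMul_sub (Real.sqrt_nonneg _) he0.le L.trajBound_of_l2 hridge hu a

/-- Numerical consequences of the sample size condition for the regression part. -/
theorem sampleSize_consequences {N d lg lam e₀ : ℝ} (hd : 1 ≤ d) (hlg : 1 / 2 ≤ lg)
    (hlam0 : 0 < lam) (hlam1 : lam ≤ 1) (he0 : 0 < e₀) (he1 : e₀ ≤ 1)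
    (h : 2 ^ 22 * (d ^ 3 * lg) ≤ N * (e₀ ^ 2 * lam ^ 2)) :
    0 < N ∧ 256 * d ≤ N * lam * e₀ ∧ 512 * lg ≤ N * lam ^ 2 * (e₀ / (64 * √d)) ^ 2 := by
  have hd0 : 0 < d := by linarith
  have hd3 : d ≤ d ^ 3 := le_self_pow₀ hd (by norm_num)
  have h1 : 2 ^ 22 * (d * lg) ≤ N * (e₀ ^ 2 * lam ^ 2) :=
    le_trans (by gcongr) h
  have hN : 0 < N := by
    have : 0 < N * (e₀ ^ 2 * lam ^ 2) := lt_of_lt_of_le (by positivity) h1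
    exact pos_of_mul_pos_left this (by positivity)
  refine ⟨hN, ?_, ?_⟩
  · have h2 : N * (e₀ ^ 2 * lam ^ 2) ≤ N * lam * e₀ := by
      have h3 : e₀ * lam ≤ 1 := mul_le_one₀ he1 hlam0.le hlam1
      have h4 : 0 ≤ N * lam * e₀ := by positivity
      calc N * (e₀ ^ 2 * lam ^ 2) = N * lam * e₀ * (e₀ * lam) := by ring
        _ ≤ N * lam * e₀ := mul_le_of_le_one_right h4 h3
    have h5 : d * (1 / 2) ≤ d * lg := mul_le_mul_of_nonneg_left hlg hd0.le
    linarith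
  · rw [div_pow, mul_pow, Real.sq_sqrt hd0.le, ← mul_div_assoc, le_div_iff₀ (by positivity)]
    have h6 : 0 ≤ d * lg := by positivity
    linarith

end Final

end ATST

theorem corollary1 :
    ∃ c : ℝ, 0 < c ∧
      ∀ (S : Type*) (A : Type*) [MeasurableSpace S] [Fintype A] [MeasurableSpace A]
        [MeasurableSingletonClass A] [TopologicalSpace A] [DiscreteTopology A]
        (𝓜 : ATST.MDP S A) (d : ℕ) (L : ATST.LinearModel 𝓜 d)
        (D : Measure (S × A)) [IsProbabilityMeasure D]
        (_ : (ATST.secondMoment L.φ D).PosDef)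
        (p : ℝ) (_ : p ∈ Set.Ioo (0 : ℝ) 1) (ε : ℝ) (_ : ε ∈ Set.Ioo (0 : ℝ) 1)
        (Ω : Type*) [MeasurableSpace Ω] (Pr : Measure Ω) [IsProbabilityMeasure Pr]
        (N : ℕ) (z : Fin N → Ω → ATST.Sample S A)
        (_ : iIndepFun z Pr) (_ : ∀ n, HasLaw (z n) (𝓜.sampleLaw D) Pr),
        -- burst probabilities estimated from the data
        (0 < ATST.pMin D →
          c * (d ^ 3 * Real.log (2 * Fintype.card A * d / p) /
            (ε ^ 2 * (1 - 𝓜.γ) ^ 2 *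
              min (ATST.lambdaMin (ATST.secondMoment L.φ D) ^ 2) (d ^ 2 * ATST.pMin D))) ≤ N →
          ∀ εM εβ : ℝ, 0 ≤ εM → 0 ≤ εβ → 32 * d * (εM + εβ / √d) / (1 - 𝓜.γ) = ε →
            ATST.HoldsWithProb Pr (1 - p) fun ω =>
              ATST.IsAdmissible ε L.ψ
                (ATST.normalizedFeatureMap L.φ 𝓜.γ (ATST.empiricalBurst fun n => z n ω)
                  (ATST.ridge L.φ 1 fun n => z n ω) εM εβ)) ∧
        -- burst probabilities known
        (c * (d ^ 3 * Real.log (2 * Fintype.card A * d / p) /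
            (ε ^ 2 * (1 - 𝓜.γ) ^ 2 *
              ATST.lambdaMin (ATST.secondMoment L.φ D) ^ 2)) ≤ N →
          ∀ εM : ℝ, 0 ≤ εM → 32 * d * εM / (1 - 𝓜.γ) = ε →
            ATST.HoldsWithProb Pr (1 - p) fun ω =>
              ATST.IsAdmissible ε L.ψ
                (ATST.normalizedFeatureMap L.φ 𝓜.γ (fun a => (𝓜.β a : ℝ))
                  (ATST.ridge L.φ 1 fun n => z n ω) εM 0)) := by
  -- `512 log (2 A d / p) ≤ N λ² e²` with `e = ε (1 - γ) / (64 √d)` is the most demanding requirement;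
  -- it needs the constant `512 · 64² = 2 ^ 21`.
  refine ⟨2 ^ 22, by positivity, ?_⟩
  intro S A _ _ _ _ _ _ 𝓜 d L D _ hpd p hp ε hε Ω _ Pr _ N z hind hlaw
  have hγ0 := 𝓜.γ_mem.1
  have hγ1 := 𝓜.γ_mem.2
  have h1γ : 0 < 1 - 𝓜.γ := by linarith
  have hA : Nonempty A := by
    obtain ⟨y⟩ : Nonempty (S × A) := nonempty_of_isProbabilityMeasure D
    exact ⟨y.2⟩
  have hA1 : (1 : ℝ) ≤ Fintype.card A := by exact_mod_cast Fintype.card_pos (α := A)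
  have hε0 := hε.1
  have he₀0 : 0 < ε * (1 - 𝓜.γ) := mul_pos hε.1 h1γ
  have he₀1 : ε * (1 - 𝓜.γ) ≤ 1 := mul_le_one₀ hε.2.le h1γ.le (by linarith)
  -- in dimension `0` the tolerance equation would force `ε = 0`
  have hdpos : ∀ y : ℝ, 32 * (d : ℝ) * y / (1 - 𝓜.γ) = ε → 0 < d := fun y hy => by
    rcases Nat.eq_zero_or_pos d with rfl | h
    · simp only [Nat.cast_zero, mul_zero, zero_mul, zero_div] at hy
      exact absurd hε.1 (by rw [← hy]; exact lt_irrefl 0)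
    · exact h
  set lam := ATST.lambdaMin (ATST.secondMoment L.φ D) with hlam
  set lg := Real.log (2 * Fintype.card A * d / p) with hlg
  have hreg : 0 < d → 2 ^ 22 * (d ^ 3 * lg) ≤ N * ((ε * (1 - 𝓜.γ)) ^ 2 * lam ^ 2) →
      0 < N ∧ 256 * (d : ℝ) ≤ N * lam * (ε * (1 - 𝓜.γ)) ∧
      (Measure.pi fun _ : Fin N => 𝓜.sampleLaw D).real
        (ATST.badRegression L D N (ε * (1 - 𝓜.γ) / (64 * √d))) ≤ p / 4 := fun hd h => by
    have hd1 : (1 : ℝ) ≤ d := by exact_mod_cast hd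
    have hsd1 : 1 ≤ √(d : ℝ) := Real.one_le_sqrt.2 hd1
    obtain ⟨h1, h2, h3⟩ := ATST.sampleSize_consequences hd1
      (ATST.one_half_le_log hA1 hd1 hp.1 hp.2) (ATST.lambdaMin_pos hd hpd)
      (ATST.lambdaMin_secondMoment_le_one L hd hpd) he₀0 he₀1 h
    have hN : 0 < N := by exact_mod_cast h1
    refine ⟨hN, h2, ATST.measure_badRegression_le L hd hN hpd hp.1 hp.2 (by positivity) ?_ h3⟩
    exact div_le_one_of_le₀ (by linarith) (by positivity)
  refine ⟨fun hpm hN εM εβ _ _ hεβ => ?_, fun hN εM _ hεM => ?_⟩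
  · have hd := hdpos _ hεβ
    have hd1 : (1 : ℝ) ≤ d := by exact_mod_cast hd
    have hlam0 : 0 < lam := ATST.lambdaMin_pos hd hpd
    have hlg0 := ATST.one_half_le_log hA1 hd1 hp.1 hp.2
    have hmin : 0 < min (lam ^ 2) (d ^ 2 * ATST.pMin D) :=
      lt_min (by positivity) (by positivity)
    rw [← mul_div_assoc, div_le_iff₀ (mul_pos (by positivity) hmin), ← mul_pow] at hN
    obtain ⟨hN0, hbias, hbadM⟩ := hreg hd (hN.trans (by
      gcongr
      exact min_le_left _ _))
    have hNp : 2 ^ 22 * lg ≤ N * ATST.pMin D * (ε * (1 - 𝓜.γ)) ^ 2 := by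
      have h1 : 2 ^ 22 * (d ^ 3 * lg) ≤ N * ((ε * (1 - 𝓜.γ)) ^ 2 * (d ^ 2 * ATST.pMin D)) :=
        hN.trans (by
          gcongr
          exact min_le_right _ _)
      have h2 : (d : ℝ) ^ 2 * (2 ^ 22 * lg) ≤ 2 ^ 22 * (d ^ 3 * lg) := by
        have h3 : (d : ℝ) ^ 2 ≤ d ^ 3 := pow_le_pow_right₀ hd1 (by norm_num)
        have h4 : (d : ℝ) ^ 2 * lg ≤ d ^ 3 * lg := mul_le_mul_of_nonneg_right h3 (by linarith)
        linarith
      refine le_of_mul_le_mul_left (h2.trans (h1.trans (le_of_eq ?_))) (by positivity :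
        (0 : ℝ) < d ^ 2)
      ring
    have hbadB := ATST.measure_badBurst_le (𝓜 := 𝓜) (D := D) (N := N) hd hp.1 hp.2
      (η := ε * (1 - 𝓜.γ) / 64) (by positivity) (by linarith) fun a => by
        have h1 : ATST.pMin D ≤ D.real {z | z.2 = a} := ciInf_le (Set.finite_range _).bddBelow a
        have h2 : N * ATST.pMin D * (ε * (1 - 𝓜.γ)) ^ 2 ≤
            N * D.real {z | z.2 = a} * (ε * (1 - 𝓜.γ)) ^ 2 := by gcongr
        rw [← hlg, div_pow]
        linarith
    refine ATST.holdsWithProb_of_pi hind hlaw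
      ((ATST.measurableSet_badRegression L).union ATST.measurableSet_badBurst)
      ((measureReal_union_le _ _).trans ((add_le_add hbadM hbadB).trans (by linarith [hp.1])))
      (good := fun x => ATST.IsAdmissible ε L.ψ
        (ATST.normalizedFeatureMap L.φ 𝓜.γ (ATST.empiricalBurst x) (ATST.ridge L.φ 1 x) εM εβ))
      fun x hx => ?_
    rw [Set.mem_union, not_or] at hx
    refine ATST.isAdmissible_of_notMem_badRegression L hd hN0 hpd hε.1 hε.2 hbias hx.1
      (ATST.empiricalBurst_mem x) (fun a => ?_) hεβ
    have hxa := hx.2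
    simp only [ATST.badBurst, Set.mem_iUnion, Set.mem_union, Set.mem_ofPred_eq, not_exists, not_or,
      not_le, Finset.sum_neg_distrib] at hxa
    obtain ⟨h1, h2, h3⟩ := hxa a
    exact ATST.abs_empiricalBurst_sub_le (by positivity) h1 (abs_le.2 ⟨by linarith, h2.le⟩)
  · have hd := hdpos _ hεM
    have hlam0 : 0 < lam := ATST.lambdaMin_pos hd hpd
    rw [← mul_div_assoc, div_le_iff₀ (by positivity), ← mul_pow] at hN
    obtain ⟨hN0, hbias, hbadM⟩ := hreg hd hN
    refine ATST.holdsWithProb_of_pi hind hlaw (ATST.measurableSet_badRegression L)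
      (hbadM.trans (by linarith [hp.1]))
      (good := fun x => ATST.IsAdmissible ε L.ψ
        (ATST.normalizedFeatureMap L.φ 𝓜.γ (fun a => (𝓜.β a : ℝ)) (ATST.ridge L.φ 1 x) εM 0))
      fun x hx => ?_
    refine ATST.isAdmissible_of_notMem_badRegression L hd hN0 hpd hε.1 hε.2 hbias hx
      (fun a => (𝓜.β a).2) (fun a => ?_) (by rw [zero_div, add_zero]; exact hεM)
    rw [sub_self, abs_zero]
    positivity
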